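/- Let $\mathbf{x}=(x_1,x_2,\dots)$ be a sequence of $N$ variables, where $N\in\{0,1,2,\dots\}\cup\{\infty\}$, and let $\mathbf{a}=(a_k)_{k\in\mathbb{Z}}$ be further variables. For partitions $\mu\subseteq\lambda$, an edge labeled tableau $T$ of shape $\lambda/\mu$ is a semistandard filling of the boxes of $\lambda/\mu$ (English convention; rows weakly and columns strictly increasing) by positive integers $\le N$, together with a set of positive integers $\le N$ on each horizontal edge, only finitely many labels in total, such that every label is strictly greater than the entry of the box of $\lambda/\mu$ directly above its edge and strictly smaller than the entry of the box of $\lambda/\mu$ directly below it (when these boxes exist). The edges which may carry labels are, in each column $j\ge 1$, those lying below row $i$ with $\mu'_j\le i\le\lambda'_j$, where $\lambda'_j,\mu'_j$ are the column lengths and row $0$ is a row of infinite length above the diagram. The weight of $T$ is the product of $x_b$ over all box entries $b$ and of $x_\ell\, a_{c}$ over all edge labels $\ell$, where $c=(\text{column})-(\text{row})$ is the content of the position directly below the edge carrying $\ell$. The edge Schur function is $$E^{\lambda/\mu}(\mathbf{x}|\mathbf{a})=\sum_{T}\mathrm{wt}(T)\in\mathbb{Z}[\![\mathbf{a}]\!][\![\mathbf{x}]\!],$$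 the sum being over all edge labeled tableaux of shape $\lambda/\mu$; set $E^{\lambda/\mu}=0$ if $\mu\not\subseteq\lambda$, and $E^\lambda=E^{\lambda/\emptyset}$. Let $s_{\lambda/\mu}(\mathbf{x})$ be the skew Schur function. Theorem. (1) Each monomial is the weight of only finitely many edge labeled tableaux of shape $\lambda/\mu$, so $E^{\lambda/\mu}$ is well defined. It is invariant under all permutations of the variables $\mathbf{x}$, and the coefficient of each monomial in $\mathbf{a}$ has bounded degree in $\mathbf{x}$; that is, $E^{\lambda/\mu}\in\Lambda[\![\mathbf{a}]\!]$, where $\Lambda$ is the ring of symmetric functions in $\mathbf{x}$ over $\mathbb{Z}$. (2) If $\mu\subseteq\lambda$, then $E^{\lambda/\mu}=s_{\lambda/\mu}+(\text{higher order terms})$, where every monomial $\mathbf{x}^\alpha\mathbf{a}^\beta$ in the higher order terms satisfies $|\beta|>0$ and $|\alpha|=|\lambda|-|\mu|+|\beta|$. (3) The functions $E^\lambda$, over all partitions $\lambda$ of length at most $N$, form a basis of the completed ring of symmetric functions over $\mathbb{Z}[\![\mathbf{a}]\!]$: each monomial in $\mathbf{x}$ occurs in only finitely many $E^\lambda$,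 and every $f\in\mathbb{Z}[\![\mathbf{a}]\!][\![\mathbf{x}]\!]$ that is invariant under all permutations of $\mathbf{x}$ can be written in exactly one way as a (possibly infinite) sum $f=\sum_\lambda c_\lambda E^\lambda$ with $c_\lambda\in\mathbb{Z}[\![\mathbf{a}]\!]$. Moreover $f\in\Lambda[\![\mathbf{a}]\!]$ if and only if each monomial in $\mathbf{a}$ occurs in only finitely many $c_\lambda$. -/

import Mathlib

noncomputable section

namespace EdgeSchur

/-- The ordered alphabet indexing the variables `x_1, x_2, …` : it has `N` letters if `N` is finite,
and it is a copy of the positive integers if `N = ⊤`. The number `i` stands for the letter `i + 1`. -/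
abbrev Alphabet (N : ℕ∞) : Type := {i : ℕ // (i : ℕ∞) < N}

/-- The ring `ℤ⟦a⟧` of formal power series in the variables `a_k`, `k ∈ ℤ`. -/
abbrev ASeries : Type := MvPowerSeries ℤ ℤ

/-- The ring `ℤ⟦a⟧⟦x⟧`, with one variable `x_i` for each letter of the alphabet. -/
abbrev XSeries (N : ℕ∞) : Type := MvPowerSeries (Alphabet N) ASeries

/-- Semistandard tableaux of skew shape `lam / mu` with entries in the ordered alphabet `σ`.
The box `(i, j)` is the one in row `i + 1` and column `j + 1` (English convention). -/
structure SkewTableau (σ : Type) [LinearOrder σ] (lam mu : YoungDiagram) where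
  /-- the entry of each box of the skew shape -/
  entry : ↥(lam.cells \ mu.cells) → σ
  /-- entries weakly increase along rows -/
  row_weak : ∀ b b' : ↥(lam.cells \ mu.cells),
    b.1.1 = b'.1.1 → b.1.2 ≤ b'.1.2 → entry b ≤ entry b'
  /-- entries strictly increase down columns -/
  col_strict : ∀ b b' : ↥(lam.cells \ mu.cells),
    b.1.2 = b'.1.2 → b.1.1 < b'.1.1 → entry b < entry b'

/-- Edge labeled tableaux of shape `lam / mu`. A horizontal edge of the grid is addressed by the
position `(i, j)` of the box whose *upper* edge it is. The edges that may carry labels are the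
horizontal edges of the boxes of `lam / mu` (upper and lower ones), and, in a column without boxes
of `lam / mu`, the bottom edge of that column of `mu` (for an empty column, this is the bottom edge
of a "zeroth row" of infinite length). The element `((i, j), l)` of `labels` says that the label `l`
lies in the set on the edge `(i, j)`; so each edge carries a set of letters, and the total number
of labels is finite. -/
structure EdgeLabeledTableau (σ : Type) [LinearOrder σ] (lam mu : YoungDiagram) extends
    SkewTableau σ lam mu where
  /-- all pairs (edge, label on this edge) -/
  labels : Finset ((ℕ × ℕ) × σ)
  /-- labels sit only on the admissible edges -/
  label_mem : ∀ p ∈ labels, mu.colLen p.1.2 ≤ p.1.1 ∧ p.1.1 ≤ lam.colLen p.1.2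
  /-- a label is strictly greater than the entry of the box above its edge -/
  above_lt : ∀ (b : ↥(lam.cells \ mu.cells)) (l : σ),
    ((b.1.1 + 1, b.1.2), l) ∈ labels → entry b < l
  /-- a label is strictly smaller than the entry of the box below its edge -/
  lt_below : ∀ (b : ↥(lam.cells \ mu.cells)) (l : σ),
    ((b.1.1, b.1.2), l) ∈ labels → l < entry b

variable {σ : Type} [LinearOrder σ] {lam mu : YoungDiagram}

/-- The exponent of the monomial `∏ x_b` over the entries `b` of a semistandard tableau. -/
def SkewTableau.xExp (T : SkewTableau σ lam mu) : σ →₀ ℕ :=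
  ∑ b, Finsupp.single (T.entry b) 1

/-- The exponent of `x` in the weight: one factor `x_b` for each entry `b` of a box and one factor
`x_l` for each edge label `l`. -/
def EdgeLabeledTableau.xExp (T : EdgeLabeledTableau σ lam mu) : σ →₀ ℕ :=
  T.toSkewTableau.xExp + ∑ p ∈ T.labels, Finsupp.single p.2 1

/-- The exponent of `a` in the weight: one factor `a_c` for each edge label, where `c = j - i` is the
content of the position `(i, j)` directly below its edge. -/
def EdgeLabeledTableau.aExp (T : EdgeLabeledTableau σ lam mu) : ℤ →₀ ℕ :=
  ∑ p ∈ T.labels, Finsupp.single ((p.1.2 : ℤ) - (p.1.1 : ℤ)) 1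

/-- The set of edge labeled tableaux with weight `x ^ α * a ^ β`. -/
def tableauxOfWeight (lam mu : YoungDiagram) (α : σ →₀ ℕ) (β : ℤ →₀ ℕ) :
    Set (EdgeLabeledTableau σ lam mu) :=
  {T | T.xExp = α ∧ T.aExp = β}

open Classical in
/-- The edge Schur function `E^{lam/mu}(x|a)` in `N` variables `x` (infinitely many if `N = ⊤`):
the generating series of edge labeled tableaux of shape `lam / mu`, and `0` unless `mu ⊆ lam`. -/
def edgeSchur (N : ℕ∞) (lam mu : YoungDiagram) : XSeries N :=
  if mu ≤ lam then fun α β =>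
    ((tableauxOfWeight (σ := Alphabet N) lam mu α β).ncard : ℤ)
  else 0

open Classical in
/-- The skew Schur function `s_{lam/mu}(x)` in `N` variables, with integer coefficients: the
generating series of semistandard tableaux of shape `lam / mu`, and `0` unless `mu ⊆ lam`. -/
def skewSchur (N : ℕ∞) (lam mu : YoungDiagram) : MvPowerSeries (Alphabet N) ℤ :=
  if mu ≤ lam then fun α =>
    (({T | T.xExp = α} : Set (SkewTableau (Alphabet N) lam mu)).ncard : ℤ)
  else 0

/-- Invariance under all permutations of the variables `x`. -/
def IsSymmetricX {N : ℕ∞} (f : XSeries N) : Prop :=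
  ∀ e : Equiv.Perm (Alphabet N), MvPowerSeries.rename e f = f

/-- For each monomial `a ^ β`, the coefficient of `a ^ β` in `f` is a series in `x` of bounded
degree. For symmetric `f`, this says that these coefficients are symmetric functions in the usual
sense, i.e. that `f` lies in `Λ⟦a⟧`. -/
def HasBoundedDegreeX {N : ℕ∞} (f : XSeries N) : Prop :=
  ∀ β : ℤ →₀ ℕ, ∃ d : ℕ, ∀ α : Alphabet N →₀ ℕ, (f.coeff α).coeff β ≠ 0 → α.degree ≤ d

/-- Partitions of length at most `N`. -/
abbrev PartitionOfLength (N : ℕ∞) : Type := {lam : YoungDiagram // (lam.colLen 0 : ℕ∞) ≤ N}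

/-- `f = ∑ c_lam * E^lam`, the sum being taken coefficientwise in `x`, with only finitely many
nonzero terms in each coefficient. -/
def IsExpansion {N : ℕ∞} (c : PartitionOfLength N → ASeries) (f : XSeries N) : Prop :=
  ∀ α : Alphabet N →₀ ℕ,
    {lam : PartitionOfLength N | c lam * (edgeSchur N lam.1 ⊥).coeff α ≠ 0}.Finite ∧
      f.coeff α = ∑ᶠ lam : PartitionOfLength N, c lam * (edgeSchur N lam.1 ⊥).coeff α

end EdgeSchur

end

/-!
Inserting the letters in increasing order turns an edge labeled tableau into a chain of diagrams in
which each step is a horizontal strip. So `E^{lam/mu}` is an entry of a product of transfer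
matrices, one for each letter, and it is symmetric because these matrices commute. In the product
of the matrices of `x` and `y`, the intermediate diagrams between `mu` and `kap` are found by
choosing the length of each row independently. The columns in which `kap` does not have exactly one
box more than `mu` contribute factors symmetric in `x` and `y`. The other columns form rows in
which a boundary between entries `x` and entries `y` moves; the sum over its positions telescopes
after multiplication by `x - y`, which shows that it is symmetric too.

All entries in row `i` are at least `i`. Hence, among the edge labeled tableaux of straight shape
`lam`, the weighted degree `∑ i * α_i` of the weight in `x` is smallest for exactly one tableau: it
has no labels, and weight `x ^ lam`. So the coefficients of the monomials `x ^ lam` in the series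
`E^mu` form a unitriangular matrix, while a symmetric series is determined by its coefficients at
these monomials. Each label contributes one variable `x` and one variable `a`, so the coefficient
of `a ^ β` in `E^lam` has degree `|lam| + |β|`; this compares the degrees of `f` with the sizes of
the partitions in its expansion.
-/

noncomputable section

namespace EdgeSchur

open Finset

section YoungDiagram

variable {lam mu nu : YoungDiagram}

theorem lt_rowLen_iff_lt_colLen {i j : ℕ} : j < lam.rowLen i ↔ i < lam.colLen j := by
  rw [← YoungDiagram.mem_iff_lt_rowLen, YoungDiagram.mem_iff_lt_colLen]

theorem le_iff_colLen_le : mu ≤ lam ↔ ∀ j, mu.colLen j ≤ lam.colLen j := by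
  refine ⟨fun h j => ?_, fun h ⟨i, j⟩ hij => ?_⟩
  · refine le_of_forall_lt fun i hi => ?_
    rw [← YoungDiagram.mem_iff_lt_colLen] at hi ⊢
    exact h hi
  · rw [YoungDiagram.mem_iff_lt_colLen] at hij ⊢
    exact hij.trans_le (h j)

theorem le_iff_rowLen_le : mu ≤ lam ↔ ∀ i, mu.rowLen i ≤ lam.rowLen i := by
  refine ⟨fun h i => ?_, fun h ⟨i, j⟩ hij => ?_⟩
  · refine le_of_forall_lt fun j hj => ?_
    rw [← YoungDiagram.mem_iff_lt_rowLen] at hj ⊢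
    exact h hj
  · rw [YoungDiagram.mem_iff_lt_rowLen] at hij ⊢
    exact hij.trans_le (h i)

theorem eq_of_rowLen_eq (h : ∀ i, mu.rowLen i = lam.rowLen i) : mu = lam :=
  le_antisymm (le_iff_rowLen_le.2 fun i => (h i).le) (le_iff_rowLen_le.2 fun i => (h i).ge)

theorem colLen_eq_zero_of_rowLen_le {j : ℕ} (h : lam.rowLen 0 ≤ j) : lam.colLen j = 0 := by
  have := lt_rowLen_iff_lt_colLen (lam := lam) (i := 0) (j := j)
  omega

theorem rowLen_eq_zero_of_colLen_le {i : ℕ} (h : lam.colLen 0 ≤ i) : lam.rowLen i = 0 := by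
  have := lt_rowLen_iff_lt_colLen (lam := lam) (i := i) (j := 0)
  omega

theorem finite_cells_subset (s : Finset (ℕ × ℕ)) : {nu : YoungDiagram | nu.cells ⊆ s}.Finite :=
  s.powerset.finite_toSet.preimage (fun _ _ _ _ h => YoungDiagram.ext h) |>.subset fun _ h =>
    mem_coe.2 (mem_powerset.2 h)

open Classical in
instance : LocallyFiniteOrderBot YoungDiagram :=
  LocallyFiniteOrderBot.ofIic YoungDiagram (fun lam => (finite_cells_subset lam.cells).toFinset)
    fun _ _ => by simp [YoungDiagram.cells_subset_iff]

theorem exists_rowLen_eq {r : ℕ → ℕ} (hr : Antitone r) {K : ℕ} (hK : r K = 0) :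
    ∃ nu : YoungDiagram, ∀ i, nu.rowLen i = r i := by
  let nu : YoungDiagram :=
    { cells := {p ∈ range K ×ˢ range (r 0) | p.2 < r p.1}
      isLowerSet := by
        rintro ⟨i, j⟩ ⟨i', j'⟩ ⟨hi : i' ≤ i, hj : j' ≤ j⟩ h
        have := hr hi
        have := hr (Nat.zero_le i')
        simp only [coe_filter, mem_product, mem_range, Set.mem_ofPred_eq] at h ⊢
        omega }
  have mem_nu (i j : ℕ) : (i, j) ∈ nu ↔ j < r i := by
    have hi : K ≤ i → r i = 0 := fun h => Nat.le_zero.1 (hK ▸ hr h)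
    have := hr (Nat.zero_le i)
    rw [← YoungDiagram.mem_cells]
    simp only [nu, mem_filter, mem_product, mem_range]
    omega
  refine ⟨nu, fun i => eq_of_forall_lt_iff fun j => ?_⟩
  rw [← mem_nu, YoungDiagram.mem_iff_lt_rowLen]

end YoungDiagram

section Boundary

variable {R : Type*} [CommRing R]

/-- The factor of column `j` in a row of free columns whose first boxes, up to column `r`, are
filled with the letter `x` and the others with the letter `y`: a box filled with `x` leaves room for
the label `y` below it, and a box filled with `y` for the label `x` above it. -/
def freeWeight (b : ℕ → R) (x y : R) (r j : ℕ) : R :=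
  if j < r then x * (1 + y * b j) else y * (1 + x * b (j + 1))

/-- The generating function of a row of free columns `lo ≤ j < hi`, summed over the position of the
boundary between the letters `x` and `y`. -/
def boundarySum (b : ℕ → R) (lo hi : ℕ) (x y : R) : R :=
  ∑ r ∈ Icc lo hi, ∏ j ∈ Ico lo hi, freeWeight b x y r j

variable (b : ℕ → R) {lo hi : ℕ} (x y : R)

theorem boundarySum_self (lo : ℕ) : boundarySum b lo lo x y = 1 := by
  simp [boundarySum]

theorem boundarySum_succ (h : lo ≤ hi) :
    boundarySum b lo (hi + 1) x y =
      boundarySum b lo hi x y * (y * (1 + x * b (hi + 1))) +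
        ∏ j ∈ Ico lo (hi + 1), x * (1 + y * b j) := by
  unfold boundarySum
  rw [sum_Icc_succ_top (by omega), sum_mul]
  congr 1
  · refine sum_congr rfl fun r hr => ?_
    rw [prod_Ico_succ_top h, freeWeight, if_neg (not_lt.2 (mem_Icc.1 hr).2)]
  · exact prod_congr rfl fun j hj => if_pos (mem_Ico.1 hj).2

theorem sub_mul_boundarySum (h : lo ≤ hi) :
    (x - y) * boundarySum b lo hi x y =
      ∏ j ∈ Ico lo (hi + 1), x * (1 + y * b j) - ∏ j ∈ Ico lo (hi + 1), y * (1 + x * b j) := by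
  induction hi, h using Nat.le_induction with
  | base => simp [boundarySum_self]; ring
  | succ hi h ih =>
    rw [boundarySum_succ b x y h, mul_add, ← mul_assoc, ih,
      prod_Ico_succ_top (by omega : lo ≤ hi + 1), prod_Ico_succ_top (by omega : lo ≤ hi + 1)]
    ring

theorem boundarySum_comm (lo hi : ℕ) : boundarySum b lo hi x y = boundarySum b lo hi y x := by
  rcases le_or_gt lo hi with h | h
  · induction hi, h using Nat.le_induction with
    | base => rw [boundarySum_self, boundarySum_self]
    | succ hi h ih =>
      rw [boundarySum_succ b x y h, boundarySum_succ b y x h, ← ih]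
      linear_combination -sub_mul_boundarySum b x y h
  · simp [boundarySum, Icc_eq_empty_of_lt h]

end Boundary

section Strip

variable {lam mu nu kap : YoungDiagram}

/-- `nu / mu` is a horizontal strip: it has at most one box in each column. -/
def IsStrip (mu nu : YoungDiagram) : Prop :=
  ∀ j, mu.colLen j ≤ nu.colLen j ∧ nu.colLen j ≤ mu.colLen j + 1

theorem IsStrip.le (h : IsStrip mu nu) : mu ≤ nu :=
  le_iff_colLen_le.2 fun j => (h j).1

theorem isStrip_iff_rowLen :
    IsStrip mu nu ↔ ∀ i, mu.rowLen i ≤ nu.rowLen i ∧ nu.rowLen (i + 1) ≤ mu.rowLen i := by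
  have hcol : (∀ j, nu.colLen j ≤ mu.colLen j + 1) ↔ ∀ i, nu.rowLen (i + 1) ≤ mu.rowLen i := by
    refine ⟨fun h i => le_of_forall_lt fun j hj => ?_, fun h j => le_of_forall_lt fun i hi => ?_⟩
    · rw [lt_rowLen_iff_lt_colLen] at hj ⊢
      have := h j
      omega
    · rcases i with - | i
      · omega
      · rw [← lt_rowLen_iff_lt_colLen] at hi
        exact Nat.succ_lt_succ (lt_rowLen_iff_lt_colLen.1 (hi.trans_le (h i)))
  rw [IsStrip, forall_and, forall_and, ← le_iff_colLen_le, le_iff_rowLen_le, hcol]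

/-- The smallest possible length of row `i` of a diagram `nu` such that `nu / mu` and `kap / nu`
are horizontal strips. -/
def rowLo (mu kap : YoungDiagram) (i : ℕ) : ℕ := max (mu.rowLen i) (kap.rowLen (i + 1))

/-- The largest possible length of row `i` of a diagram `nu` such that `nu / mu` and `kap / nu`
are horizontal strips. -/
def rowHi (mu kap : YoungDiagram) : ℕ → ℕ
  | 0 => kap.rowLen 0
  | i + 1 => min (kap.rowLen (i + 1)) (mu.rowLen i)

theorem isStrip_and_isStrip_iff :
    IsStrip mu nu ∧ IsStrip nu kap ↔
      ∀ i, nu.rowLen i ∈ Icc (rowLo mu kap i) (rowHi mu kap i) := by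
  simp only [isStrip_iff_rowLen, mem_Icc, rowLo, max_le_iff]
  refine ⟨fun ⟨h, h'⟩ i => ⟨⟨(h i).1, (h' i).2⟩, ?_⟩, fun h =>
    ⟨fun i => ⟨(h i).1.1, (le_min_iff.1 (h (i + 1)).2).2⟩, fun i => ⟨?_, (h i).1.2⟩⟩⟩
  · cases i with
    | zero => exact (h' 0).1
    | succ i => exact le_min (h' (i + 1)).1 (h i).2
  · cases i with
    | zero => exact (h 0).2
    | succ i => exact (le_min_iff.1 (h (i + 1)).2).1

theorem rowHi_succ_le_rowLo (mu kap : YoungDiagram) (i : ℕ) :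
    rowHi mu kap (i + 1) ≤ rowLo mu kap i :=
  (min_le_right _ _).trans (le_max_left _ _)

theorem mem_Ico_rowLo_rowHi {i j : ℕ} :
    j ∈ Ico (rowLo mu kap i) (rowHi mu kap i) ↔ mu.colLen j = i ∧ kap.colLen j = i + 1 := by
  have mu_lt (i : ℕ) := lt_rowLen_iff_lt_colLen (lam := mu) (i := i) (j := j)
  have kap_lt (i : ℕ) := lt_rowLen_iff_lt_colLen (lam := kap) (i := i) (j := j)
  rw [mem_Ico, rowLo, max_le_iff, ← not_lt, ← not_lt, mu_lt, kap_lt]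
  cases i with
  | zero =>
    rw [rowHi, kap_lt]
    omega
  | succ i =>
    rw [rowHi, lt_min_iff, kap_lt, mu_lt]
    omega

theorem rowLo_rowHi_eq_zero {i : ℕ} (hmu : mu ≤ lam) (hkap : kap ≤ lam) (hi : lam.colLen 0 ≤ i) :
    rowLo mu kap i = 0 ∧ rowHi mu kap i = 0 := by
  have rowLen_eq_zero {nu : YoungDiagram} (h : nu ≤ lam) {i : ℕ} (hi : lam.colLen 0 ≤ i) :
      nu.rowLen i = 0 :=
    rowLen_eq_zero_of_colLen_le ((le_iff_colLen_le.1 h 0).trans hi)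
  refine ⟨by simp [rowLo, rowLen_eq_zero hmu hi, rowLen_eq_zero hkap (hi.trans i.le_succ)], ?_⟩
  cases i with
  | zero => exact rowLen_eq_zero hkap hi
  | succ i => simp [rowHi, rowLen_eq_zero hkap hi]

theorem exists_isStrip_rowLen_eq (hmu : mu ≤ lam) (hkap : kap ≤ lam) {r : Fin (lam.colLen 0) → ℕ}
    (hr : ∀ i : Fin _, r i ∈ Icc (rowLo mu kap i) (rowHi mu kap i)) :
    ∃ nu, (IsStrip mu nu ∧ IsStrip nu kap) ∧ ∀ i : Fin (lam.colLen 0), nu.rowLen i = r i := by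
  set r' : ℕ → ℕ := fun i => if h : i < lam.colLen 0 then r ⟨i, h⟩ else 0
  have mem_Icc_row (i : ℕ) : r' i ∈ Icc (rowLo mu kap i) (rowHi mu kap i) := by
    by_cases h : i < lam.colLen 0
    · simpa only [r', dif_pos h] using hr ⟨i, h⟩
    · simp [r', h, rowLo_rowHi_eq_zero hmu hkap (not_lt.1 h)]
  have antitone : Antitone r' := antitone_nat_of_succ_le fun i =>
    (mem_Icc.1 (mem_Icc_row (i + 1))).2.trans
      ((rowHi_succ_le_rowLo mu kap i).trans (mem_Icc.1 (mem_Icc_row i)).1)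
  obtain ⟨nu, hnu⟩ := exists_rowLen_eq antitone (K := lam.colLen 0) (by simp [r'])
  exact ⟨nu, isStrip_and_isStrip_iff.2 fun i => hnu i ▸ mem_Icc_row i, fun i => by simp [hnu, r']⟩

open Classical in
theorem sum_isStrip_prod_rowLen {R : Type*} [CommSemiring R] (hmu : mu ≤ lam) (hkap : kap ≤ lam)
    (F : ℕ → ℕ → R) :
    ∑ nu ∈ Iic lam with IsStrip mu nu ∧ IsStrip nu kap,
        ∏ i ∈ range (lam.colLen 0), F i (nu.rowLen i) =
      ∏ i ∈ range (lam.colLen 0), ∑ r ∈ Icc (rowLo mu kap i) (rowHi mu kap i), F i r := by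
  rw [Finset.prod_range (fun i => ∑ r ∈ Icc (rowLo mu kap i) (rowHi mu kap i), F i r),
    prod_univ_sum]
  refine sum_bij (fun nu _ i => nu.rowLen i) (fun nu hnu => ?_) (fun nu hnu nu' hnu' h => ?_)
    (fun r hr => ?_) fun nu _ => Finset.prod_range _
  · rw [mem_filter, isStrip_and_isStrip_iff] at hnu
    exact Fintype.mem_piFinset.2 fun i => hnu.2 i
  · simp only [mem_filter, mem_Iic] at hnu hnu'
    refine eq_of_rowLen_eq fun i => ?_
    rcases lt_or_ge i (lam.colLen 0) with hi | hi
    · exact congrFun h ⟨i, hi⟩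
    · have hi' : lam.rowLen i = 0 := rowLen_eq_zero_of_colLen_le hi
      have := le_iff_rowLen_le.1 hnu.1 i
      have := le_iff_rowLen_le.1 hnu'.1 i
      omega
  · obtain ⟨nu, hstrip, hnu⟩ := exists_isStrip_rowLen_eq hmu hkap (Fintype.mem_piFinset.1 hr)
    exact ⟨nu, mem_filter.2 ⟨mem_Iic.2 (hstrip.2.le.trans hkap), hstrip⟩, funext hnu⟩

end Strip

section TransferMatrix

variable {R : Type*} [CommRing R] {lam mu nu kap : YoungDiagram}

/-- The weight of column `j` of a one-letter edge labeled tableau, summed over its labels, when the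
letter `x` raises the length of the column from `m` to `n`. -/
def colWeight (a : ℤ → R) (x : R) (j m n : ℕ) : R :=
  if n = m then 1 + x * a ((j : ℤ) - m) else if n = m + 1 then x else 0

/-- The generating function of the one-letter edge labeled tableaux of shape `nu / mu` with labels
in the first `M` columns only. -/
def stripWeight (a : ℤ → R) (M : ℕ) (x : R) (mu nu : YoungDiagram) : R :=
  ∏ j ∈ range M, colWeight a x j (mu.colLen j) (nu.colLen j)

/-- The generating function of one column of length `m` with a letter `x`, then a letter `y`
raising it to length `n`, when the boxes containing these letters are determined by `m` and `n`. -/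
def fixedWeight (a : ℤ → R) (x y : R) (j m n : ℕ) : R :=
  if n = m then (1 + x * a ((j : ℤ) - m)) * (1 + y * a ((j : ℤ) - m)) else x * y

variable {a : ℤ → R} {M : ℕ} {x y : R}

theorem colWeight_eq_zero {j m n : ℕ} (h : ¬ (m ≤ n ∧ n ≤ m + 1)) : colWeight a x j m n = 0 := by
  rw [colWeight, if_neg (by omega), if_neg (by omega)]

theorem stripWeight_eq_zero (hM : lam.rowLen 0 ≤ M) (hmu : mu ≤ lam) (hnu : nu ≤ lam)
    (h : ¬ IsStrip mu nu) : stripWeight a M x mu nu = 0 := by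
  obtain ⟨j, hj⟩ := not_forall.1 h
  refine prod_eq_zero (mem_range.2 (lt_of_not_ge fun hMj => hj ?_)) (colWeight_eq_zero hj)
  have := le_iff_colLen_le.1 hmu j
  have := le_iff_colLen_le.1 hnu j
  have := colLen_eq_zero_of_rowLen_le (hM.trans hMj)
  omega

theorem colWeight_mul_colWeight_of_ne {j m k n : ℕ} (hmk : m ≤ k ∧ k ≤ m + 1)
    (hkn : k ≤ n ∧ n ≤ k + 1) (hn : n ≠ m + 1) :
    colWeight a x j m k * colWeight a y j k n = fixedWeight a x y j m n := by
  unfold colWeight fixedWeight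
  obtain ⟨rfl, rfl⟩ | ⟨rfl, rfl⟩ : k = m ∧ n = m ∨ k = m + 1 ∧ n = m + 2 := by omega
  · simp
  · simp

theorem colWeight_mul_colWeight_succ {i j : ℕ} (hi : i ≤ nu.colLen j ∧ nu.colLen j ≤ i + 1) :
    colWeight a x j i (nu.colLen j) * colWeight a y j (nu.colLen j) (i + 1) =
      freeWeight (fun j => a ((j : ℤ) - i - 1)) x y (nu.rowLen i) j := by
  unfold colWeight freeWeight
  simp only [lt_rowLen_iff_lt_colLen]
  obtain h | h : nu.colLen j = i ∨ nu.colLen j = i + 1 := by omega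
  · simp only [h, ↓reduceIte, lt_irrefl, Nat.add_eq_left, one_ne_zero]
    push_cast
    ring_nf
  · simp only [h, ↓reduceIte, lt_add_one, Nat.add_eq_left, one_ne_zero]
    push_cast
    ring_nf

open Classical in
theorem prod_free_columns (hM : lam.rowLen 0 ≤ M) (hkap : kap ≤ lam) (f : ℕ → R) :
    ∏ j ∈ range M with kap.colLen j = mu.colLen j + 1, f j =
      ∏ i ∈ range (lam.colLen 0), ∏ j ∈ Ico (rowLo mu kap i) (rowHi mu kap i), f j := by
  have kap_colLen_le (j : ℕ) : kap.colLen j ≤ lam.colLen 0 :=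
    (le_iff_colLen_le.1 hkap j).trans (lam.colLen_anti 0 j j.zero_le)
  rw [← prod_fiberwise_of_maps_to (g := mu.colLen) (t := range (lam.colLen 0))]
  · refine prod_congr rfl fun i _ => prod_congr (ext fun j => ?_) fun _ _ => rfl
    have hj : kap.colLen j ≠ 0 → j < M := fun h => by
      by_contra! hMj
      have := colLen_eq_zero_of_rowLen_le (hM.trans hMj)
      have := le_iff_colLen_le.1 hkap j
      omega
    simp only [mem_filter, mem_range, mem_Ico_rowLo_rowHi]
    omega
  · intro j hj
    have := kap_colLen_le j
    simp only [mem_filter, mem_range] at hj ⊢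
    omega

theorem stripWeight_mul_stripWeight (hM : lam.rowLen 0 ≤ M) (hkap : kap ≤ lam)
    (h : IsStrip mu nu) (h' : IsStrip nu kap) :
    stripWeight a M x mu nu * stripWeight a M y nu kap =
      (∏ j ∈ range M with kap.colLen j ≠ mu.colLen j + 1,
        fixedWeight a x y j (mu.colLen j) (kap.colLen j)) *
      ∏ i ∈ range (lam.colLen 0), ∏ j ∈ Ico (rowLo mu kap i) (rowHi mu kap i),
        freeWeight (fun j => a ((j : ℤ) - i - 1)) x y (nu.rowLen i) j := by
  rw [stripWeight, stripWeight, ← prod_mul_distrib,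
    ← prod_filter_not_mul_prod_filter (range M) fun j => kap.colLen j = mu.colLen j + 1,
    prod_free_columns hM hkap]
  congr 1
  · exact prod_congr rfl fun j hj =>
      colWeight_mul_colWeight_of_ne (h j) (h' j) (mem_filter.1 hj).2
  · refine prod_congr rfl fun i _ => prod_congr rfl fun j hj => ?_
    obtain ⟨rfl, hj'⟩ := mem_Ico_rowLo_rowHi.1 hj
    rw [hj', colWeight_mul_colWeight_succ (h j)]

theorem sum_stripWeight_mul (hM : lam.rowLen 0 ≤ M) (hmu : mu ≤ lam) (hkap : kap ≤ lam) :
    ∑ nu ∈ Iic lam, stripWeight a M x mu nu * stripWeight a M y nu kap =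
      (∏ j ∈ range M with kap.colLen j ≠ mu.colLen j + 1,
        fixedWeight a x y j (mu.colLen j) (kap.colLen j)) *
      ∏ i ∈ range (lam.colLen 0),
        boundarySum (fun j => a ((j : ℤ) - i - 1)) (rowLo mu kap i) (rowHi mu kap i) x y := by
  classical
  calc ∑ nu ∈ Iic lam, stripWeight a M x mu nu * stripWeight a M y nu kap
      = ∑ nu ∈ Iic lam with IsStrip mu nu ∧ IsStrip nu kap,
          stripWeight a M x mu nu * stripWeight a M y nu kap := by
        refine (sum_filter_of_ne fun nu hnu hne => ?_).symm
        rw [mem_Iic] at hnu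
        exact ⟨not_imp_comm.1 (stripWeight_eq_zero hM hmu hnu) (left_ne_zero_of_mul hne),
          not_imp_comm.1 (stripWeight_eq_zero hM hnu hkap) (right_ne_zero_of_mul hne)⟩
    _ = _ := by
        rw [sum_congr rfl fun nu hnu => stripWeight_mul_stripWeight hM hkap
          (mem_filter.1 hnu).2.1 (mem_filter.1 hnu).2.2, ← mul_sum]
        exact congrArg _ (sum_isStrip_prod_rowLen hmu hkap fun i r =>
          ∏ j ∈ Ico (rowLo mu kap i) (rowHi mu kap i),
            freeWeight (fun j => a ((j : ℤ) - i - 1)) x y r j)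

theorem fixedWeight_comm (a : ℤ → R) (x y : R) (j m n : ℕ) :
    fixedWeight a x y j m n = fixedWeight a y x j m n := by
  simp only [fixedWeight, mul_comm]

/-- The transfer matrix of the letter `x` on the diagrams contained in `lam`, in the first `M`
columns. -/
def transferMatrix (a : ℤ → R) (M : ℕ) (lam : YoungDiagram) (x : R) :
    Matrix (Set.Iic lam) (Set.Iic lam) R :=
  .of fun mu nu => stripWeight a M x mu nu

theorem commute_transferMatrix (hM : lam.rowLen 0 ≤ M) (x y : R) :
    Commute (transferMatrix a M lam x) (transferMatrix a M lam y) := by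
  ext mu kap
  have mul_apply (x y : R) : (transferMatrix a M lam x * transferMatrix a M lam y) mu kap =
      ∑ nu ∈ Iic lam, stripWeight a M x mu nu * stripWeight a M y nu kap :=
    (sum_subtype _ (fun _ => mem_Iic)
      fun nu => stripWeight a M x mu nu * stripWeight a M y nu kap).symm
  simp only [mul_apply, sum_stripWeight_mul hM mu.2 kap.2, boundarySum_comm _ x y,
    fixedWeight_comm a x y]

end TransferMatrix

section LowerShape

variable {σ : Type} [LinearOrder σ] {lam mu : YoungDiagram} {l : σ}

attribute [ext] EdgeLabeledTableau

theorem mem_cells_sdiff_cells {b : ℕ × ℕ} : b ∈ lam.cells \ mu.cells ↔ b ∈ lam ∧ b ∉ mu := by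
  simp

theorem mk_mem_cells_sdiff_cells {i j : ℕ} :
    (i, j) ∈ lam.cells \ mu.cells ↔ mu.colLen j ≤ i ∧ i < lam.colLen j := by
  rw [mem_cells_sdiff_cells, YoungDiagram.mem_iff_lt_colLen, YoungDiagram.mem_iff_lt_colLen,
    not_lt, and_comm]

theorem SkewTableau.monotone_entry (T : SkewTableau σ lam mu) : Monotone T.entry := by
  rintro ⟨⟨i, j⟩, hb⟩ ⟨⟨i', j'⟩, hb'⟩ ⟨hi : i ≤ i', hj : j ≤ j'⟩
  have hcorner : (i, j') ∈ lam.cells \ mu.cells := by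
    rw [mem_cells_sdiff_cells] at hb hb' ⊢
    exact ⟨lam.up_left_mem hi le_rfl hb'.1, fun h => hb.2 (mu.up_left_mem le_rfl hj h)⟩
  refine (T.row_weak ⟨_, hb⟩ ⟨_, hcorner⟩ rfl hj).trans ?_
  rcases hi.eq_or_lt with rfl | hi
  · exact le_rfl
  · exact (T.col_strict ⟨_, hcorner⟩ ⟨_, hb'⟩ rfl hi).le

open Classical in
/-- The diagram formed by the boxes of `mu` in `lam` and the boxes of `T` with entries at most
`l`. -/
def SkewTableau.lowerShape (T : SkewTableau σ lam mu) (l : σ) : YoungDiagram where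
  cells := {b ∈ lam.cells | ∀ h : b ∈ lam.cells \ mu.cells, T.entry ⟨b, h⟩ ≤ l}
  isLowerSet := by
    intro b b' hle hb
    simp only [coe_filter, Set.mem_ofPred_eq, YoungDiagram.mem_cells] at hb ⊢
    refine ⟨lam.isLowerSet hle hb.1, fun h => ?_⟩
    have hmem : b ∈ lam.cells \ mu.cells := mem_cells_sdiff_cells.2
      ⟨hb.1, fun hmu => (mem_cells_sdiff_cells.1 h).2 (mu.isLowerSet hle hmu)⟩
    exact (T.monotone_entry (a := ⟨b', h⟩) (b := ⟨b, hmem⟩) hle).trans (hb.2 hmem)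

namespace SkewTableau

variable {T : SkewTableau σ lam mu}

theorem mem_lowerShape {b : ℕ × ℕ} :
    b ∈ T.lowerShape l ↔ b ∈ lam ∧ ∀ h : b ∈ lam.cells \ mu.cells, T.entry ⟨b, h⟩ ≤ l := by
  simp [lowerShape, ← YoungDiagram.mem_cells]

theorem coe_mem_lowerShape (b : ↥(lam.cells \ mu.cells)) :
    b.1 ∈ T.lowerShape l ↔ T.entry b ≤ l := by
  rw [mem_lowerShape]
  exact ⟨fun h => h.2 b.2, fun h => ⟨(mem_cells_sdiff_cells.1 b.2).1, fun _ => h⟩⟩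

theorem lowerShape_le : T.lowerShape l ≤ lam :=
  fun _ hb => (mem_lowerShape.1 hb).1

theorem le_lowerShape (hmu : mu ≤ lam) : mu ≤ T.lowerShape l := fun _ hb =>
  mem_lowerShape.2 ⟨hmu hb, fun h => absurd hb (mem_cells_sdiff_cells.1 h).2⟩

theorem isStrip_lowerShape (hmu : mu ≤ lam) (hl : ∀ b, l ≤ T.entry b) :
    IsStrip mu (T.lowerShape l) := by
  intro j
  refine ⟨le_iff_colLen_le.1 (le_lowerShape hmu) j, ?_⟩
  by_contra! hlt
  have mem_skew {i : ℕ} (hi : mu.colLen j ≤ i) (hi' : i < (T.lowerShape l).colLen j) :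
      (i, j) ∈ lam.cells \ mu.cells :=
    mk_mem_cells_sdiff_cells.2 ⟨hi, hi'.trans_le (le_iff_colLen_le.1 lowerShape_le j)⟩
  let upper : ↥(lam.cells \ mu.cells) := ⟨(mu.colLen j, j), mem_skew le_rfl (by omega)⟩
  let lower : ↥(lam.cells \ mu.cells) := ⟨(mu.colLen j + 1, j), mem_skew (by omega) hlt⟩
  have hlower : T.entry lower ≤ l :=
    (coe_mem_lowerShape lower).1 (YoungDiagram.mem_iff_lt_colLen.2 hlt)
  have hlt_entry : T.entry upper < T.entry lower :=
    T.col_strict upper lower rfl (Nat.lt_succ_self _)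
  exact ((hl upper).trans_lt (hlt_entry.trans_le hlower)).false

end SkewTableau

namespace EdgeLabeledTableau

/-- All letters of the tableau, in boxes and on edges, lie in `s`. -/
def HasLettersIn (T : EdgeLabeledTableau σ lam mu) (s : Set σ) : Prop :=
  (∀ b, T.entry b ∈ s) ∧ ∀ p ∈ T.labels, p.2 ∈ s

variable {T : EdgeLabeledTableau σ lam mu}

theorem HasLettersIn.mono {s t : Set σ} (h : T.HasLettersIn s) (hst : s ⊆ t) : T.HasLettersIn t :=
  ⟨fun b => hst (h.1 b), fun p hp => hst (h.2 p hp)⟩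

theorem colLen_lowerShape_le {i j : ℕ} {k : σ} (h : ((i, j), k) ∈ T.labels) (hk : l ≤ k) :
    (T.lowerShape l).colLen j ≤ i := by
  by_contra! hlt
  have hmem : (i, j) ∈ T.lowerShape l := YoungDiagram.mem_iff_lt_colLen.2 hlt
  have hskew : (i, j) ∈ lam.cells \ mu.cells := mk_mem_cells_sdiff_cells.2
    ⟨(T.label_mem _ h).1, hlt.trans_le (le_iff_colLen_le.1 SkewTableau.lowerShape_le j)⟩
  exact (hk.trans_lt (T.lt_below ⟨_, hskew⟩ k h)).not_ge
    ((SkewTableau.coe_mem_lowerShape ⟨_, hskew⟩).1 hmem)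

theorem eq_colLen_of_minimal_label (hl : ∀ b, l ≤ T.entry b) {i j : ℕ}
    (h : ((i, j), l) ∈ T.labels) : i = mu.colLen j := by
  obtain ⟨hlo : mu.colLen j ≤ i, hhi : i ≤ lam.colLen j⟩ := T.label_mem _ h
  refine hlo.antisymm' (not_lt.1 fun hlt => ?_)
  obtain ⟨i, rfl⟩ := Nat.exists_eq_succ_of_ne_zero (Nat.ne_zero_of_lt hlt)
  have hskew : (i, j) ∈ lam.cells \ mu.cells :=
    mk_mem_cells_sdiff_cells.2 ⟨Nat.lt_succ_iff.1 hlt, hhi⟩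
  exact (T.above_lt ⟨_, hskew⟩ l h).not_ge (hl _)

end EdgeLabeledTableau

end LowerShape

section AddLetter

variable {σ : Type} [LinearOrder σ] {lam mu nu : YoungDiagram}

/-- Add to a tableau of shape `lam / nu` the letter `l` in all boxes of the horizontal strip
`nu / mu`. -/
def SkewTableau.addLetter (T : SkewTableau σ lam nu) (l : σ) (hT : ∀ b, l < T.entry b)
    (hstrip : IsStrip mu nu) : SkewTableau σ lam mu where
  entry b := if h : b.1 ∈ lam.cells \ nu.cells then T.entry ⟨b.1, h⟩ else l
  row_weak b b' hrow hcol := by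
    split_ifs with hb hb' hb'
    · exact T.row_weak _ _ hrow hcol
    · rw [mem_cells_sdiff_cells] at hb
      exact absurd (mem_cells_sdiff_cells.2 ⟨(mem_cells_sdiff_cells.1 b'.2).1,
        fun h => hb.2 (nu.isLowerSet ⟨hrow.le, hcol⟩ h)⟩) hb'
    · exact (hT _).le
    · exact le_rfl
  col_strict := by
    rintro ⟨⟨i, j⟩, hb⟩ ⟨⟨i', _⟩, hb'⟩ (rfl : j = _) (hi : i < i')
    have := hstrip j
    simp only [mk_mem_cells_sdiff_cells] at hb hb' ⊢
    split_ifs with h h'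
    · exact T.col_strict _ _ rfl hi
    · omega
    · exact hT _
    · omega

/-- Add to a tableau of shape `lam / nu` the letter `l` in all boxes of the horizontal strip
`nu / mu` and as a label in the columns in `A`. -/
def EdgeLabeledTableau.addLetter (T : EdgeLabeledTableau σ lam nu) (l : σ)
    (hT : T.HasLettersIn (Set.Ioi l)) (hstrip : IsStrip mu nu) (hnu : nu ≤ lam) (A : Finset ℕ)
    (hA : ∀ j ∈ A, nu.colLen j = mu.colLen j) : EdgeLabeledTableau σ lam mu where
  toSkewTableau := T.toSkewTableau.addLetter l hT.1 hstrip
  labels := T.labels ∪ A.image fun j => ((mu.colLen j, j), l)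
  label_mem p hp := by
    rcases mem_union.1 hp with hp | hp
    · exact ⟨((hstrip _).1).trans (T.label_mem p hp).1, (T.label_mem p hp).2⟩
    · obtain ⟨j, -, rfl⟩ := mem_image.1 hp
      exact ⟨le_rfl, le_iff_colLen_le.1 (hstrip.le.trans hnu) j⟩
  above_lt := by
    rintro ⟨⟨i, j⟩, hb⟩ k hk
    simp only [SkewTableau.addLetter]
    rcases mem_union.1 hk with hk | hk
    · split_ifs with h
      · exact T.above_lt ⟨_, h⟩ k hk
      · exact hT.2 _ hk
    · obtain ⟨_, -, hk⟩ := mem_image.1 hk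
      obtain ⟨⟨hi, rfl⟩, -⟩ := by simpa only [Prod.mk.injEq] using hk
      have := (mk_mem_cells_sdiff_cells.1 hb).1
      omega
  lt_below := by
    rintro ⟨⟨i, j⟩, hb⟩ k hk
    simp only [SkewTableau.addLetter]
    rw [mk_mem_cells_sdiff_cells] at hb
    rcases mem_union.1 hk with hk | hk
    · rw [dif_pos (mk_mem_cells_sdiff_cells.2 ⟨(T.label_mem _ hk).1, hb.2⟩)]
      exact T.lt_below ⟨_, _⟩ k hk
    · obtain ⟨_, hj, hk⟩ := mem_image.1 hk
      obtain ⟨⟨rfl, rfl⟩, rfl⟩ := by simpa only [Prod.mk.injEq] using hk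
      rw [dif_pos (mk_mem_cells_sdiff_cells.2 ⟨(hA _ hj).le, hb.2⟩)]
      exact hT.1 _

/-- Restrict a tableau to the boxes outside `nu` and to the labels greater than `l` on the edges
which are admissible for `lam / nu`. -/
def EdgeLabeledTableau.restrict (T : EdgeLabeledTableau σ lam mu) (l : σ) (hmn : mu ≤ nu) :
    EdgeLabeledTableau σ lam nu where
  entry b := T.entry ⟨b.1, sdiff_subset_sdiff subset_rfl hmn b.2⟩
  row_weak _ _ hrow hcol := T.row_weak _ _ hrow hcol
  col_strict _ _ hcol hrow := T.col_strict _ _ hcol hrow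
  labels := {p ∈ T.labels | l < p.2 ∧ nu.colLen p.1.2 ≤ p.1.1}
  label_mem p hp := ⟨(mem_filter.1 hp).2.2, (T.label_mem p (mem_filter.1 hp).1).2⟩
  above_lt _ k hk := T.above_lt _ k (mem_filter.1 hk).1
  lt_below _ k hk := T.lt_below _ k (mem_filter.1 hk).1

/-- The columns carrying the label `l`. -/
def EdgeLabeledTableau.labelColumns (T : EdgeLabeledTableau σ lam mu) (l : σ) : Finset ℕ :=
  {p ∈ T.labels | p.2 = l}.image fun p => p.1.2

namespace EdgeLabeledTableau

theorem mem_labelColumns {T : EdgeLabeledTableau σ lam mu} {l : σ} {j : ℕ} :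
    j ∈ T.labelColumns l ↔ ∃ i, ((i, j), l) ∈ T.labels := by
  simp [labelColumns]

section Add

variable {T : EdgeLabeledTableau σ lam nu} {l : σ} (hT : T.HasLettersIn (Set.Ioi l))
  (hstrip : IsStrip mu nu) (hnu : nu ≤ lam) {A : Finset ℕ}
  (hA : ∀ j ∈ A, nu.colLen j = mu.colLen j)

theorem entry_addLetter (b : ↥(lam.cells \ mu.cells)) :
    (T.addLetter l hT hstrip hnu A hA).entry b =
      if h : b.1 ∈ lam.cells \ nu.cells then T.entry ⟨b.1, h⟩ else l := rfl

theorem labels_addLetter :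
    (T.addLetter l hT hstrip hnu A hA).labels =
      T.labels ∪ A.image fun j => ((mu.colLen j, j), l) := rfl

theorem lowerShape_addLetter : (T.addLetter l hT hstrip hnu A hA).lowerShape l = nu := by
  refine SetLike.ext fun b => ?_
  rw [SkewTableau.mem_lowerShape]
  simp only [entry_addLetter]
  refine ⟨fun ⟨hb, hle⟩ => ?_, fun hb => ⟨hnu hb, fun _ => ?_⟩⟩
  · by_contra hbnu
    have hskew : b ∈ lam.cells \ nu.cells := mem_cells_sdiff_cells.2 ⟨hb, hbnu⟩
    have hle := hle (sdiff_subset_sdiff subset_rfl hstrip.le hskew)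
    rw [dif_pos hskew] at hle
    exact (hT.1 _).not_ge hle
  · rw [dif_neg fun h => (mem_cells_sdiff_cells.1 h).2 hb]

theorem hasLettersIn_addLetter {s : Set σ} (hTs : T.HasLettersIn s) :
    (T.addLetter l hT hstrip hnu A hA).HasLettersIn (insert l s) := by
  refine ⟨fun b => ?_, fun p hp => ?_⟩
  · rw [entry_addLetter]
    split_ifs with h
    · exact Or.inr (hTs.1 _)
    · exact Or.inl rfl
  · rw [labels_addLetter, mem_union, mem_image] at hp
    rcases hp with hp | ⟨j, -, rfl⟩
    · exact Or.inr (hTs.2 p hp)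
    · exact Or.inl rfl

theorem labelColumns_addLetter : (T.addLetter l hT hstrip hnu A hA).labelColumns l = A := by
  ext j
  have hl (i : ℕ) : ((i, j), l) ∉ T.labels := fun h => (hT.2 _ h).false
  simp [mem_labelColumns, labels_addLetter, hl]

theorem restrict_addLetter :
    (T.addLetter l hT hstrip hnu A hA).restrict l hstrip.le = T := by
  refine EdgeLabeledTableau.ext (funext fun b => dif_pos b.2) (ext fun p => ?_)
  simp only [restrict, labels_addLetter, mem_filter, mem_union, mem_image]
  refine ⟨?_, fun hp => ⟨Or.inl hp, hT.2 p hp, (T.label_mem p hp).1⟩⟩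
  rintro ⟨hp | ⟨j, -, rfl⟩, hlt, -⟩
  · exact hp
  · exact hlt.false.elim

end Add

section Restrict

variable {T : EdgeLabeledTableau σ lam mu} {l : σ}

theorem hasLettersIn_restrict (hmn : mu ≤ T.lowerShape l) {s : Set σ}
    (hT : T.HasLettersIn (insert l s)) : (T.restrict l hmn).HasLettersIn (s ∩ Set.Ioi l) := by
  refine ⟨fun b => ?_, fun p hp => ?_⟩
  · have hlt : l < (T.restrict l hmn).entry b := by
      rw [← not_le]
      exact fun hle => (mem_cells_sdiff_cells.1 b.2).2 ((SkewTableau.coe_mem_lowerShape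
        ⟨b.1, sdiff_subset_sdiff subset_rfl hmn b.2⟩).2 hle)
    exact ⟨(hT.1 _).resolve_left hlt.ne', hlt⟩
  · obtain ⟨hp, hlt, -⟩ := mem_filter.1 hp
    exact ⟨(hT.2 p hp).resolve_left hlt.ne', hlt⟩

theorem colLen_lowerShape_eq_of_mem_labelColumns (hmu : mu ≤ lam) (hT : T.HasLettersIn (Set.Ici l))
    {j : ℕ} (hj : j ∈ T.labelColumns l) : (T.lowerShape l).colLen j = mu.colLen j := by
  obtain ⟨i, hi⟩ := mem_labelColumns.1 hj
  obtain rfl := eq_colLen_of_minimal_label hT.1 hi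
  exact (colLen_lowerShape_le hi le_rfl).antisymm
    (le_iff_colLen_le.1 (SkewTableau.le_lowerShape hmu) j)

theorem addLetter_restrict (hT : T.HasLettersIn (Set.Ici l)) (hmn : mu ≤ T.lowerShape l)
    (hT' : (T.restrict l hmn).HasLettersIn (Set.Ioi l)) (hstrip : IsStrip mu (T.lowerShape l))
    (hA : ∀ j ∈ T.labelColumns l, (T.lowerShape l).colLen j = mu.colLen j) :
    (T.restrict l hmn).addLetter l hT' hstrip SkewTableau.lowerShape_le (T.labelColumns l) hA =
      T := by
  refine EdgeLabeledTableau.ext (funext fun b => ?_) (ext fun ⟨⟨i, j⟩, k⟩ => ?_)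
  · rw [entry_addLetter]
    split_ifs with h
    · rfl
    · have hb : b.1 ∈ T.lowerShape l := by
        by_contra hb
        exact h (mem_cells_sdiff_cells.2 ⟨(mem_cells_sdiff_cells.1 b.2).1, hb⟩)
      exact (hT.1 b).antisymm ((SkewTableau.coe_mem_lowerShape b).1 hb)
  · simp only [labels_addLetter, restrict, mem_union, mem_filter, mem_image, mem_labelColumns,
      Prod.mk.injEq]
    constructor
    · rintro (h | ⟨_, ⟨i', h⟩, ⟨rfl, rfl⟩, rfl⟩)
      · exact h.1
      · rwa [← eq_colLen_of_minimal_label hT.1 h]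
    · intro h
      rcases (Set.mem_Ici.1 (hT.2 _ h)).eq_or_lt with hk | hk
      · obtain rfl : l = k := hk
        exact Or.inr ⟨j, ⟨i, h⟩, ⟨(eq_colLen_of_minimal_label hT.1 h).symm, rfl⟩, rfl⟩
      · exact Or.inl ⟨h, hk, colLen_lowerShape_le h hk.le⟩

end Restrict

end EdgeLabeledTableau

end AddLetter

section Weight

open MvPolynomial

variable {σ : Type} [LinearOrder σ] {lam mu nu : YoungDiagram}

/-- The variable `a_c` in the polynomial ring `ℤ[a][x]`. -/
def aVar (σ : Type) (c : ℤ) : MvPolynomial σ (MvPolynomial ℤ ℤ) := C (X c)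

/-- The weight of an edge labeled tableau, as a polynomial in `x` with coefficients in `ℤ[a]`. -/
def EdgeLabeledTableau.wt (T : EdgeLabeledTableau σ lam mu) :
    MvPolynomial σ (MvPolynomial ℤ ℤ) :=
  (∏ b, X (T.entry b)) * ∏ p ∈ T.labels, X p.2 * aVar σ ((p.1.2 : ℤ) - p.1.1)

theorem EdgeLabeledTableau.wt_eq_monomial (T : EdgeLabeledTableau σ lam mu) :
    T.wt = monomial T.xExp (monomial T.aExp 1) := by
  have prod_X {ι : Type} (s : Finset ι) (f : ι → σ) :
      ∏ i ∈ s, (X (f i) : MvPolynomial σ (MvPolynomial ℤ ℤ)) =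
        monomial (∑ i ∈ s, Finsupp.single (f i) 1) 1 :=
    (monomial_sum_one ..).symm
  have prod_aVar : ∏ p ∈ T.labels, aVar σ ((p.1.2 : ℤ) - p.1.1) = C (monomial T.aExp 1) := by
    rw [EdgeLabeledTableau.aExp, monomial_sum_one, map_prod]
    rfl
  rw [EdgeLabeledTableau.wt, prod_mul_distrib, prod_aVar, prod_X, prod_X, ← mul_assoc,
    monomial_mul, mul_comm, C_mul_monomial, EdgeLabeledTableau.xExp, SkewTableau.xExp]
  simp only [mul_one]

theorem prod_cells_sdiff_cells {R : Type*} [CommMonoid R] (hmn : mu ≤ nu) (hnl : nu ≤ lam)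
    (f : ℕ × ℕ → R) :
    ∏ b ∈ lam.cells \ mu.cells, f b =
      (∏ b ∈ nu.cells \ mu.cells, f b) * ∏ b ∈ lam.cells \ nu.cells, f b := by
  rw [← prod_sdiff (sdiff_subset_sdiff subset_rfl hmn : lam.cells \ nu.cells ⊆ _)]
  congr 2
  ext b
  have := @hnl b
  simp only [mem_sdiff, YoungDiagram.mem_cells] at this ⊢
  tauto

theorem EdgeLabeledTableau.wt_addLetter {T : EdgeLabeledTableau σ lam nu} {l : σ}
    (hT : T.HasLettersIn (Set.Ioi l)) (hstrip : IsStrip mu nu) (hnu : nu ≤ lam) {A : Finset ℕ}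
    (hA : ∀ j ∈ A, nu.colLen j = mu.colLen j) :
    (T.addLetter l hT hstrip hnu A hA).wt =
      X l ^ #(nu.cells \ mu.cells) * (∏ j ∈ A, X l * aVar σ ((j : ℤ) - mu.colLen j)) * T.wt := by
  have prod_entry : ∏ b, X ((T.addLetter l hT hstrip hnu A hA).entry b) =
      X l ^ #(nu.cells \ mu.cells) *
        ∏ b, (X (T.entry b) : MvPolynomial σ (MvPolynomial ℤ ℤ)) := by
    let f (b : ℕ × ℕ) : MvPolynomial σ (MvPolynomial ℤ ℤ) :=
      X (if h : b ∈ lam.cells \ nu.cells then T.entry ⟨b, h⟩ else l)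
    change ∏ b : ↥(lam.cells \ mu.cells), f b = _
    rw [prod_coe_sort _ f, prod_cells_sdiff_cells hstrip.le hnu, ← prod_const]
    congr 1
    · refine prod_congr rfl fun b hb => congrArg X (dif_neg fun h => ?_)
      exact (mem_sdiff.1 h).2 (mem_sdiff.1 hb).1
    · rw [← prod_coe_sort _ f]
      exact prod_congr rfl fun b _ => congrArg X (dif_pos b.2)
  have disjoint_labels : Disjoint T.labels (A.image fun j => ((mu.colLen j, j), l)) := by
    rw [Finset.disjoint_left]
    intro p hp hpA
    obtain ⟨j, -, rfl⟩ := mem_image.1 hpA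
    exact (hT.2 _ hp).false
  rw [wt, wt, prod_entry, labels_addLetter, prod_union disjoint_labels, prod_image]
  · ring
  · intro j _ j' _ h
    exact congrArg (fun p : (ℕ × ℕ) × σ => p.1.2) h

end Weight

section TableauxSum

open MvPolynomial

variable {σ : Type} [LinearOrder σ] {lam mu nu : YoungDiagram} {S : Finset σ} {M : ℕ} {l : σ}

theorem finite_hasLettersIn (S : Finset σ) (M : ℕ) :
    {T : EdgeLabeledTableau σ lam mu |
      T.HasLettersIn S ∧ ∀ p ∈ T.labels, p.1.2 < M}.Finite := by
  let L : Finset ((ℕ × ℕ) × σ) := (range (lam.colLen 0 + 1) ×ˢ range M) ×ˢ S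
  refine Set.Finite.of_finite_image
    (f := fun T : EdgeLabeledTableau σ lam mu => (T.entry, T.labels))
    (((Fintype.piFinset fun _ => S) ×ˢ L.powerset).finite_toSet.subset ?_) fun T _ T' _ h =>
      EdgeLabeledTableau.ext (congrArg Prod.fst h) (congrArg Prod.snd h)
  rintro _ ⟨T, ⟨⟨hentry, hlabel⟩, hcol⟩, rfl⟩
  simp only [coe_product, Set.mem_prod, mem_coe, Fintype.mem_piFinset, mem_powerset]
  refine ⟨hentry, fun p hp => ?_⟩
  have hrow : p.1.1 ≤ lam.colLen 0 :=
    (T.label_mem p hp).2.trans (lam.colLen_anti 0 _ (Nat.zero_le _))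
  simp only [L, mem_product, mem_range]
  exact ⟨⟨Nat.lt_succ_of_le hrow, hcol p hp⟩, hlabel p hp⟩

/-- The edge labeled tableaux with letters in `S` and labels in the first `M` columns. -/
def boundedTableaux (S : Finset σ) (M : ℕ) (lam mu : YoungDiagram) :
    Finset (EdgeLabeledTableau σ lam mu) :=
  (finite_hasLettersIn S M).toFinset

theorem mem_boundedTableaux {T : EdgeLabeledTableau σ lam mu} :
    T ∈ boundedTableaux S M lam mu ↔ T.HasLettersIn S ∧ ∀ p ∈ T.labels, p.1.2 < M := by
  simp [boundedTableaux]

/-- The generating function of the edge labeled tableaux with letters in `S` and labels in the first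
`M` columns. -/
def tableauxSum (S : Finset σ) (M : ℕ) (lam mu : YoungDiagram) :
    MvPolynomial σ (MvPolynomial ℤ ℤ) :=
  ∑ T ∈ boundedTableaux S M lam mu, T.wt

theorem tableauxSum_empty_self (M : ℕ) (lam : YoungDiagram) :
    tableauxSum (∅ : Finset σ) M lam lam = 1 := by
  have isEmpty : IsEmpty ↥(lam.cells \ lam.cells) := ⟨fun b => by simpa using b.2⟩
  let T : EdgeLabeledTableau σ lam lam :=
    { entry := isEmptyElim
      row_weak := isEmptyElim
      col_strict := isEmptyElim
      labels := ∅
      label_mem := by simp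
      above_lt := isEmptyElim
      lt_below := isEmptyElim }
  have boundedTableaux_eq : boundedTableaux (∅ : Finset σ) M lam lam = {T} := by
    refine eq_singleton_iff_unique_mem.2 ⟨mem_boundedTableaux.2 ⟨⟨isEmptyElim, by simp [T]⟩,
      by simp [T]⟩, fun T' hT' => EdgeLabeledTableau.ext (Subsingleton.elim _ _) ?_⟩
    refine eq_empty_of_forall_notMem fun p hp => ?_
    simpa using (mem_boundedTableaux.1 hT').1.2 p hp
  rw [tableauxSum, boundedTableaux_eq, sum_singleton, EdgeLabeledTableau.wt]
  simp [T]

theorem tableauxSum_empty_of_ne (M : ℕ) (hmu : mu ≤ lam) (hne : mu ≠ lam) :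
    tableauxSum (∅ : Finset σ) M lam mu = 0 := by
  refine sum_eq_zero fun T hT => ?_
  obtain ⟨b, hb, hbmu⟩ := SetLike.exists_of_lt (hmu.lt_of_ne hne)
  simpa using (mem_boundedTableaux.1 hT).1.1 ⟨b, mem_cells_sdiff_cells.2 ⟨hb, hbmu⟩⟩

theorem IsStrip.card_cells_sdiff_cells (hstrip : IsStrip mu nu) (hM : nu.rowLen 0 ≤ M) :
    #(nu.cells \ mu.cells) = #{j ∈ range M | nu.colLen j ≠ mu.colLen j} := by
  refine (card_nbij' (fun j => (mu.colLen j, j)) Prod.snd ?_ ?_ ?_ ?_).symm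
  · intro j hj
    have := hstrip j
    have hne := (mem_filter.1 hj).2
    exact mk_mem_cells_sdiff_cells.2 ⟨le_rfl, by omega⟩
  · rintro ⟨i, j⟩ hb
    rw [mem_coe, mk_mem_cells_sdiff_cells] at hb
    have hj : j < nu.rowLen 0 := lt_rowLen_iff_lt_colLen.2 (by omega)
    exact mem_filter.2 ⟨mem_range.2 (hj.trans_le hM), by dsimp only; omega⟩
  · exact fun _ _ => rfl
  · rintro ⟨i, j⟩ hb
    rw [mem_coe, mk_mem_cells_sdiff_cells] at hb
    have := hstrip j
    exact Prod.ext (by dsimp only; omega) rfl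

theorem stripWeight_eq_sum {R : Type*} [CommRing R] (a : ℤ → R) (x : R)
    (hM : nu.rowLen 0 ≤ M) (hstrip : IsStrip mu nu) :
    stripWeight a M x mu nu = x ^ #(nu.cells \ mu.cells) *
      ∑ A ∈ {j ∈ range M | nu.colLen j = mu.colLen j}.powerset,
        ∏ j ∈ A, x * a ((j : ℤ) - mu.colLen j) := by
  rw [← prod_one_add, hstrip.card_cells_sdiff_cells hM, ← prod_const, stripWeight,
    ← prod_filter_not_mul_prod_filter (range M) fun j => nu.colLen j = mu.colLen j]
  congr 1
  · refine prod_congr rfl fun j hj => ?_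
    have := hstrip j
    have hne := (mem_filter.1 hj).2
    rw [colWeight, if_neg hne, if_pos (by omega)]
  · exact prod_congr rfl fun j hj => if_pos (mem_filter.1 hj).2

theorem addLetter_mem_boundedTableaux {T : EdgeLabeledTableau σ lam nu} {A : Finset ℕ}
    (hT : T ∈ boundedTableaux S M lam nu) (hTl : T.HasLettersIn (Set.Ioi l))
    (hstrip : IsStrip mu nu) (hnu : nu ≤ lam) (hA : ∀ j ∈ A, nu.colLen j = mu.colLen j)
    (hAM : ∀ j ∈ A, j < M) :
    T.addLetter l hTl hstrip hnu A hA ∈ boundedTableaux (insert l S) M lam mu := by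
  rw [mem_boundedTableaux] at hT ⊢
  refine ⟨?_, fun p hp => ?_⟩
  · rw [coe_insert]
    exact EdgeLabeledTableau.hasLettersIn_addLetter _ _ _ _ hT.1
  · rw [EdgeLabeledTableau.labels_addLetter, mem_union, mem_image] at hp
    rcases hp with hp | ⟨j, hj, rfl⟩
    · exact hT.2 p hp
    · exact hAM j hj

theorem restrict_mem_boundedTableaux {T : EdgeLabeledTableau σ lam mu}
    (hT : T ∈ boundedTableaux (insert l S) M lam mu) (hmn : mu ≤ T.lowerShape l) :
    T.restrict l hmn ∈ boundedTableaux S M lam (T.lowerShape l) := by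
  rw [mem_boundedTableaux, coe_insert] at hT
  exact mem_boundedTableaux.2
    ⟨(EdgeLabeledTableau.hasLettersIn_restrict hmn hT.1).mono Set.inter_subset_left,
      fun p hp => hT.2 p (mem_filter.1 hp).1⟩

theorem labelColumns_mem_powerset {T : EdgeLabeledTableau σ lam mu}
    (hT : T ∈ boundedTableaux (insert l S) M lam mu) (hl : T.HasLettersIn (Set.Ici l))
    (hmu : mu ≤ lam) :
    T.labelColumns l ∈ {j ∈ range M | (T.lowerShape l).colLen j = mu.colLen j}.powerset := by
  refine mem_powerset.2 fun j hj => mem_filter.2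
    ⟨mem_range.2 ?_, EdgeLabeledTableau.colLen_lowerShape_eq_of_mem_labelColumns hmu hl hj⟩
  obtain ⟨i, hi⟩ := EdgeLabeledTableau.mem_labelColumns.1 hj
  exact (mem_boundedTableaux.1 hT).2 _ hi

open Classical in
theorem sum_boundedTableaux_lowerShape_eq (hl : ∀ s ∈ S, l < s) (hM : nu.rowLen 0 ≤ M)
    (hnu : nu ≤ lam) (hstrip : IsStrip mu nu) :
    ∑ T ∈ boundedTableaux (insert l S) M lam mu with T.lowerShape l = nu, T.wt =
      stripWeight (aVar σ) M (X l) mu nu * tableauxSum S M lam nu := by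
  have hIoi : (S : Set σ) ⊆ Set.Ioi l := hl
  have hIci : ((insert l S : Finset σ) : Set σ) ⊆ Set.Ici l := by
    simpa [Set.insert_subset_iff] using hIoi.trans Set.Ioi_subset_Ici_self
  rw [stripWeight_eq_sum _ _ hM hstrip, tableauxSum, mul_assoc, sum_mul_sum, mul_sum]
  simp only [mul_sum]
  rw [← sum_product']
  have hcol (q) (hq : q ∈ {j ∈ range M | nu.colLen j = mu.colLen j}.powerset ×ˢ
      boundedTableaux S M lam nu) : ∀ j ∈ q.1, j < M ∧ nu.colLen j = mu.colLen j := fun j hj => by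
    simpa using mem_powerset.1 (mem_product.1 hq).1 hj
  have hbdd (q) (hq : q ∈ {j ∈ range M | nu.colLen j = mu.colLen j}.powerset ×ˢ
      boundedTableaux S M lam nu) := mem_boundedTableaux.1 (mem_product.1 hq).2
  symm
  refine sum_bij' (fun q hq => q.2.addLetter l ((hbdd q hq).1.mono hIoi) hstrip hnu q.1
      fun j hj => (hcol q hq j hj).2)
    (fun T _ => (T.labelColumns l, T.restrict l hstrip.le)) ?_ ?_ ?_ ?_ ?_
  · exact fun q hq => mem_filter.2 ⟨addLetter_mem_boundedTableaux (mem_product.1 hq).2 _ _ _ _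
      fun j hj => (hcol q hq j hj).1, EdgeLabeledTableau.lowerShape_addLetter ..⟩
  · intro T hTnu
    obtain ⟨hT, rfl⟩ := mem_filter.1 hTnu
    exact mem_product.2 ⟨labelColumns_mem_powerset hT ((mem_boundedTableaux.1 hT).1.mono hIci)
      (hstrip.le.trans hnu), restrict_mem_boundedTableaux hT hstrip.le⟩
  · exact fun q hq => Prod.ext (EdgeLabeledTableau.labelColumns_addLetter ..)
      (EdgeLabeledTableau.restrict_addLetter ..)
  · intro T hTnu
    obtain ⟨hT, rfl⟩ := mem_filter.1 hTnu
    exact EdgeLabeledTableau.addLetter_restrict (hmn := hstrip.le)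
      ((mem_boundedTableaux.1 hT).1.mono hIci) ..
  · intro q hq
    rw [EdgeLabeledTableau.wt_addLetter]
    ring

theorem tableauxSum_insert (hl : ∀ s ∈ S, l < s) (hM : lam.rowLen 0 ≤ M) (hmu : mu ≤ lam) :
    tableauxSum (insert l S) M lam mu =
      ∑ nu ∈ Iic lam, stripWeight (aVar σ) M (X l) mu nu * tableauxSum S M lam nu := by
  classical
  rw [tableauxSum, ← sum_fiberwise_of_maps_to (g := fun T => T.lowerShape l) (t := Iic lam)
    fun T _ => mem_Iic.2 SkewTableau.lowerShape_le]
  refine sum_congr rfl fun nu hnu => ?_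
  rw [mem_Iic] at hnu
  by_cases hstrip : IsStrip mu nu
  · exact sum_boundedTableaux_lowerShape_eq hl ((le_iff_rowLen_le.1 hnu 0).trans hM) hnu hstrip
  · rw [stripWeight_eq_zero hM hmu hnu hstrip, zero_mul]
    refine sum_eq_zero fun T hTnu => absurd ?_ hstrip
    obtain ⟨hT, rfl⟩ := mem_filter.1 hTnu
    refine SkewTableau.isStrip_lowerShape hmu fun b => ?_
    rcases mem_insert.1 ((mem_boundedTableaux.1 hT).1.1 b) with h | h
    · exact h.ge
    · exact (hl _ h).le

theorem pairwise_commute_transferMatrix {τ : Type} (S : Finset τ) (hM : lam.rowLen 0 ≤ M) :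
    (S : Set τ).Pairwise
      (Function.onFun Commute fun l => transferMatrix (aVar τ) M lam (X l)) :=
  fun _ _ _ _ _ => commute_transferMatrix hM _ _

open Classical in
theorem tableauxSum_eq_noncommProd (S : Finset σ) (hM : lam.rowLen 0 ≤ M) (mu : Set.Iic lam) :
    tableauxSum S M lam mu = S.noncommProd (fun l => transferMatrix (aVar σ) M lam (X l))
      (pairwise_commute_transferMatrix S hM) mu ⟨lam, Set.self_mem_Iic⟩ := by
  induction S using Finset.induction_on_min generalizing mu with
  | empty =>
    rw [noncommProd_empty]
    by_cases h : mu = ⟨lam, Set.self_mem_Iic⟩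
    · rw [h, Matrix.one_apply_eq, tableauxSum_empty_self]
    · rw [Matrix.one_apply_ne h, tableauxSum_empty_of_ne M mu.2 fun h' => h (Subtype.ext h')]
  | insert l S hl ih =>
    rw [noncommProd_insert_of_notMem _ _ _ _ fun h => (hl l h).false, Matrix.mul_apply,
      tableauxSum_insert hl hM mu.2]
    simp only [← ih]
    exact sum_subtype _ (fun _ => mem_Iic)
      fun nu => stripWeight (aVar σ) M (X l) mu nu * tableauxSum S M lam nu

open Classical in
theorem mapMatrix_transferMatrix {R R' : Type*} [CommRing R] [CommRing R'] (f : R →+* R')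
    (a : ℤ → R) (x : R) :
    f.mapMatrix (transferMatrix a M lam x) = transferMatrix (fun c => f (a c)) M lam (f x) := by
  ext mu nu
  simp [transferMatrix, stripWeight, colWeight, apply_ite f]

theorem noncommProd_map {ι κ β : Type*} [Monoid β] (e : ι ↪ κ) (s : Finset ι) (f : κ → β)
    (comm) :
    (s.map e).noncommProd f comm = s.noncommProd (f ∘ e) fun _ hx _ hy hne =>
      comm (mem_coe.2 (mem_map_of_mem e hx)) (mem_coe.2 (mem_map_of_mem e hy))
        (e.injective.ne hne) := by
  simp only [noncommProd, map_val, Multiset.map_map]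

theorem rename_tableauxSum (e : Equiv.Perm σ) (S : Finset σ) (hM : lam.rowLen 0 ≤ M)
    (hmu : mu ≤ lam) :
    rename e (tableauxSum S M lam mu) = tableauxSum (S.map e.toEmbedding) M lam mu := by
  classical
  let g : MvPolynomial σ (MvPolynomial ℤ ℤ) →+* MvPolynomial σ (MvPolynomial ℤ ℤ) :=
    (rename e : _ →ₐ[MvPolynomial ℤ ℤ] _)
  have hg (l : σ) : g.mapMatrix (transferMatrix (aVar σ) M lam (X l)) =
      transferMatrix (aVar σ) M lam (X (e l)) := by
    rw [mapMatrix_transferMatrix]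
    congr 1
    · exact funext fun c => rename_C _ _
    · exact rename_X _ _
  have map_noncommProd_transferMatrix := map_noncommProd S
    (fun l => transferMatrix (aVar σ) M lam (X l)) (pairwise_commute_transferMatrix S hM)
    g.mapMatrix
  simp only [hg] at map_noncommProd_transferMatrix
  rw [tableauxSum_eq_noncommProd S hM ⟨mu, hmu⟩,
    tableauxSum_eq_noncommProd (S.map e.toEmbedding) hM ⟨mu, hmu⟩, noncommProd_map]
  exact congrFun (congrFun map_noncommProd_transferMatrix _) _

end TableauxSum

section Exponents

variable {σ : Type} [LinearOrder σ] {lam mu : YoungDiagram}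

theorem support_sum_single_one {ι κ : Type*} [DecidableEq κ] (s : Finset ι) (f : ι → κ) :
    (∑ i ∈ s, Finsupp.single (f i) 1 : κ →₀ ℕ).support = s.image f := by
  ext k
  simp [Finsupp.finsetSum_apply, Finsupp.single_apply]

namespace EdgeLabeledTableau

theorem hasLettersIn_support_xExp (T : EdgeLabeledTableau σ lam mu) :
    T.HasLettersIn T.xExp.support := by
  have support_add (α β : σ →₀ ℕ) : (α + β).support = α.support ∪ β.support := by
    ext k
    simp [or_iff_not_imp_left]
  rw [xExp, SkewTableau.xExp, support_add, support_sum_single_one, support_sum_single_one]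
  exact ⟨fun b => mem_union_left _ (mem_image_of_mem _ (mem_univ b)),
    fun p hp => mem_union_right _ (mem_image_of_mem _ hp)⟩

theorem content_mem_support_aExp {T : EdgeLabeledTableau σ lam mu} {p : (ℕ × ℕ) × σ}
    (hp : p ∈ T.labels) : (p.1.2 : ℤ) - p.1.1 ∈ T.aExp.support := by
  rw [aExp, support_sum_single_one]
  exact mem_image_of_mem _ hp

theorem degree_aExp (T : EdgeLabeledTableau σ lam mu) : T.aExp.degree = #T.labels := by
  simp [aExp]

theorem degree_xExp_add_card (T : EdgeLabeledTableau σ lam mu) (hmu : mu ≤ lam) :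
    T.xExp.degree + mu.card = lam.card + T.aExp.degree := by
  have hcard : #(lam.cells \ mu.cells) + mu.card = lam.card := card_sdiff_add_card_eq_card hmu
  simp only [degree_aExp, xExp, SkewTableau.xExp, map_add, map_sum, Finsupp.degree_single,
    sum_const, smul_eq_mul, mul_one, card_univ, Fintype.card_coe, ← hcard]
  ring

end EdgeLabeledTableau

end Exponents

section Weights

open MvPolynomial

variable {σ : Type} [LinearOrder σ] {lam mu : YoungDiagram} {α : σ →₀ ℕ} {β : ℤ →₀ ℕ} {S : Finset σ}
  {M : ℕ}

theorem exists_forall_column_lt (lam : YoungDiagram) (β : ℤ →₀ ℕ) :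
    ∃ M, lam.rowLen 0 ≤ M ∧ ∀ (mu : YoungDiagram) (T : EdgeLabeledTableau σ lam mu), T.aExp = β →
      ∀ p ∈ T.labels, p.1.2 < M := by
  obtain ⟨m, hm⟩ := β.support.bddAbove
  refine ⟨max (lam.rowLen 0) (m.toNat + lam.colLen 0 + 1), le_max_left _ _, ?_⟩
  rintro mu T rfl p hp
  have := hm (EdgeLabeledTableau.content_mem_support_aExp hp)
  have := (T.label_mem p hp).2
  have := lam.colLen_anti 0 p.1.2 (Nat.zero_le _)
  omega

theorem tableauxOfWeight_subset (hS : α.support ⊆ S)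
    (hM : ∀ T : EdgeLabeledTableau σ lam mu, T.aExp = β → ∀ p ∈ T.labels, p.1.2 < M) :
    tableauxOfWeight lam mu α β ⊆ boundedTableaux S M lam mu := by
  rintro T ⟨rfl, hβ⟩
  exact mem_boundedTableaux.2 ⟨T.hasLettersIn_support_xExp.mono hS, hM T hβ⟩

theorem finite_tableauxOfWeight (lam mu : YoungDiagram) (α : σ →₀ ℕ) (β : ℤ →₀ ℕ) :
    (tableauxOfWeight lam mu α β).Finite := by
  obtain ⟨M, -, hM⟩ := exists_forall_column_lt (σ := σ) lam β
  exact (finite_toSet _).subset (tableauxOfWeight_subset subset_rfl (hM mu))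

theorem coeff_tableauxSum (hS : α.support ⊆ S)
    (hM : ∀ T : EdgeLabeledTableau σ lam mu, T.aExp = β → ∀ p ∈ T.labels, p.1.2 < M) :
    ((tableauxSum S M lam mu).coeff α).coeff β = ((tableauxOfWeight lam mu α β).ncard : ℤ) := by
  classical
  have tableauxOfWeight_eq : tableauxOfWeight lam mu α β =
      ↑{T ∈ boundedTableaux S M lam mu | T.xExp = α ∧ T.aExp = β} := by
    rw [coe_filter]
    exact Set.ext fun T => ⟨fun h => ⟨tableauxOfWeight_subset hS hM h, h⟩, fun h => h.2⟩
  rw [tableauxOfWeight_eq, Set.ncard_coe_finset, card_filter, tableauxSum, coeff_sum, coeff_sum]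
  push_cast
  refine sum_congr rfl fun T _ => ?_
  rw [EdgeLabeledTableau.wt_eq_monomial, coeff_monomial, apply_ite (coeff β), coeff_monomial,
    coeff_zero, ite_and]

theorem ncard_tableauxOfWeight_mapDomain (hmu : mu ≤ lam) (e : Equiv.Perm σ) (α : σ →₀ ℕ)
    (β : ℤ →₀ ℕ) :
    (tableauxOfWeight lam mu (α.mapDomain e) β).ncard = (tableauxOfWeight lam mu α β).ncard := by
  classical
  obtain ⟨M, hM, hM'⟩ := exists_forall_column_lt (σ := σ) lam β
  have support_subset : (α.mapDomain e).support ⊆ α.support.map e.toEmbedding := by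
    rw [map_eq_image]
    exact Finsupp.mapDomain_support
  have h := coeff_tableauxSum support_subset (hM' mu)
  rw [← rename_tableauxSum e _ hM hmu, coeff_rename_mapDomain _ e.injective,
    coeff_tableauxSum subset_rfl (hM' mu)] at h
  exact_mod_cast h.symm

/-- A semistandard tableau, regarded as an edge labeled tableau without labels. -/
def SkewTableau.toEdgeLabeledTableau (T : SkewTableau σ lam mu) : EdgeLabeledTableau σ lam mu where
  toSkewTableau := T
  labels := ∅
  label_mem := by simp
  above_lt := by simp
  lt_below := by simp

theorem ncard_tableauxOfWeight_zero (α : σ →₀ ℕ) :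
    (tableauxOfWeight lam mu α 0).ncard =
      ({T | T.xExp = α} : Set (SkewTableau σ lam mu)).ncard := by
  symm
  refine Set.ncard_congr (fun T _ => T.toEdgeLabeledTableau) (fun T hT => ⟨?_, ?_⟩)
    (fun T T' _ _ h => congrArg EdgeLabeledTableau.toSkewTableau h) ?_
  · simpa [SkewTableau.toEdgeLabeledTableau, EdgeLabeledTableau.xExp] using hT
  · rfl
  · rintro T ⟨hx, ha⟩
    have labels_eq : T.labels = ∅ := by rw [← card_eq_zero, ← T.degree_aExp, ha, map_zero]
    refine ⟨T.toSkewTableau, ?_, EdgeLabeledTableau.ext rfl labels_eq.symm⟩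
    simpa [EdgeLabeledTableau.xExp, labels_eq] using hx

end Weights

section EdgeSchurFunction

variable {N : ℕ∞} {lam mu : YoungDiagram} {α : Alphabet N →₀ ℕ} {β : ℤ →₀ ℕ}

theorem edgeSchur_of_not_le (hmu : ¬ mu ≤ lam) : edgeSchur N lam mu = 0 := if_neg hmu

theorem coeff_edgeSchur (hmu : mu ≤ lam) (α : Alphabet N →₀ ℕ) (β : ℤ →₀ ℕ) :
    ((edgeSchur N lam mu).coeff α).coeff β =
      ((tableauxOfWeight (σ := Alphabet N) lam mu α β).ncard : ℤ) :=
  congrFun (congrFun (if_pos hmu : edgeSchur N lam mu = _) α) β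

theorem coeff_skewSchur (hmu : mu ≤ lam) (α : Alphabet N →₀ ℕ) :
    (skewSchur N lam mu).coeff α =
      (({T | T.xExp = α} : Set (SkewTableau (Alphabet N) lam mu)).ncard : ℤ) :=
  congrFun (if_pos hmu : skewSchur N lam mu = _) α

theorem coeff_coeff_edgeSchur_zero (hmu : mu ≤ lam) (α : Alphabet N →₀ ℕ) :
    ((edgeSchur N lam mu).coeff α).coeff 0 = (skewSchur N lam mu).coeff α := by
  rw [coeff_edgeSchur hmu, coeff_skewSchur hmu, ncard_tableauxOfWeight_zero]

theorem exists_tableau_of_coeff_coeff_ne_zero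
    (h : ((edgeSchur N lam mu).coeff α).coeff β ≠ 0) :
    mu ≤ lam ∧ ∃ T : EdgeLabeledTableau (Alphabet N) lam mu, T.xExp = α ∧ T.aExp = β := by
  by_cases hmu : mu ≤ lam
  · rw [coeff_edgeSchur hmu, Nat.cast_ne_zero] at h
    exact ⟨hmu, Set.nonempty_of_ncard_ne_zero h⟩
  · simp [edgeSchur_of_not_le hmu] at h

theorem exists_tableau_of_coeff_ne_zero (h : (edgeSchur N lam mu).coeff α ≠ 0) :
    ∃ T : EdgeLabeledTableau (Alphabet N) lam mu, T.xExp = α := by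
  obtain ⟨β, hβ⟩ := MvPowerSeries.ne_zero_iff_exists_coeff_ne_zero _ |>.1 h
  obtain ⟨-, T, hT, -⟩ := exists_tableau_of_coeff_coeff_ne_zero hβ
  exact ⟨T, hT⟩

theorem degree_add_card_of_coeff_ne_zero (h : ((edgeSchur N lam mu).coeff α).coeff β ≠ 0) :
    α.degree + mu.card = lam.card + β.degree := by
  obtain ⟨hmu, T, rfl, rfl⟩ := exists_tableau_of_coeff_coeff_ne_zero h
  exact T.degree_xExp_add_card hmu

theorem coeff_mapDomain_rename (e : Equiv.Perm (Alphabet N)) (f : XSeries N)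
    (α : Alphabet N →₀ ℕ) :
    (MvPowerSeries.rename e f).coeff (α.mapDomain e) = f.coeff α := by
  have h := MvPowerSeries.coeff_embDomain_rename e.toEmbedding f α
  rwa [Finsupp.embDomain_eq_mapDomain] at h

theorem isSymmetricX_iff {f : XSeries N} :
    IsSymmetricX f ↔ ∀ (e : Equiv.Perm (Alphabet N)) (α : Alphabet N →₀ ℕ),
      f.coeff (α.mapDomain e) = f.coeff α := by
  refine forall_congr' fun e => ⟨fun h α => ?_, fun h => ?_⟩
  · rw [← coeff_mapDomain_rename e f α, h]
  · ext1 α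
    obtain ⟨α, rfl⟩ := Finsupp.mapDomain_surjective e.surjective α
    rw [coeff_mapDomain_rename, h]

theorem isSymmetricX_edgeSchur (N : ℕ∞) (lam mu : YoungDiagram) :
    IsSymmetricX (edgeSchur N lam mu) := by
  by_cases hmu : mu ≤ lam
  · refine isSymmetricX_iff.2 fun e α => MvPowerSeries.ext fun β => ?_
    rw [coeff_edgeSchur hmu, coeff_edgeSchur hmu, ncard_tableauxOfWeight_mapDomain hmu]
  · rw [edgeSchur_of_not_le hmu]
    exact fun e => map_zero _

theorem hasBoundedDegreeX_edgeSchur (N : ℕ∞) (lam mu : YoungDiagram) :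
    HasBoundedDegreeX (edgeSchur N lam mu) := by
  refine fun β => ⟨lam.card + β.degree, fun α h => ?_⟩
  rw [← degree_add_card_of_coeff_ne_zero h]
  exact Nat.le_add_right _ _

theorem exists_edgeSchur_eq_map_skewSchur_add (N : ℕ∞) (hmu : mu ≤ lam) :
    ∃ H : XSeries N,
      edgeSchur N lam mu = MvPowerSeries.map MvPowerSeries.C (skewSchur N lam mu) + H ∧
      ∀ (α : Alphabet N →₀ ℕ) (β : ℤ →₀ ℕ), (H.coeff α).coeff β ≠ 0 →
        0 < β.degree ∧ α.degree + mu.card = lam.card + β.degree := by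
  classical
  refine ⟨edgeSchur N lam mu - MvPowerSeries.map MvPowerSeries.C (skewSchur N lam mu),
    (add_sub_cancel _ _).symm, fun α β h => ?_⟩
  rw [map_sub, map_sub, MvPowerSeries.coeff_map, MvPowerSeries.coeff_C] at h
  split_ifs at h with hβ
  · rw [hβ, coeff_coeff_edgeSchur_zero hmu, sub_self] at h
    exact absurd rfl h
  · rw [sub_zero] at h
    exact ⟨Nat.pos_of_ne_zero (hβ ∘ (Finsupp.degree_eq_zero_iff β).1),
      degree_add_card_of_coeff_ne_zero h⟩

end EdgeSchurFunction

section UnitriangularSystem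

variable {ι R : Type*} [Ring R] {rank : ι → ℕ} {m : ι → ι → R}

theorem finsum_mul_eq_add_sum (finite_rank_lt : ∀ n, {i | rank i < n}.Finite)
    (m_self : ∀ i, m i i = 1) (triangular : ∀ i j, m i j ≠ 0 → i = j ∨ rank i < rank j)
    (c : ι → R) (j : ι) :
    ∑ᶠ i, c i * m i j = c j + ∑ i ∈ (finite_rank_lt (rank j)).toFinset, c i * m i j := by
  classical
  rw [finsum_eq_sum_of_support_subset (s := insert j (finite_rank_lt (rank j)).toFinset),
    sum_insert (by simp), m_self, mul_one]
  intro i hi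
  simpa using triangular i j (right_ne_zero_of_mul hi)

theorem existsUnique_finsum_mul_eq (finite_rank_lt : ∀ n, {i | rank i < n}.Finite)
    (m_self : ∀ i, m i i = 1) (triangular : ∀ i j, m i j ≠ 0 → i = j ∨ rank i < rank j)
    (g : ι → R) : ∃! c : ι → R, ∀ j, ∑ᶠ i, c i * m i j = g j := by
  simp only [finsum_mul_eq_add_sum finite_rank_lt m_self triangular]
  let lower (j : ι) : Finset ι := (finite_rank_lt (rank j)).toFinset
  have rank_lt {i j : ι} (hi : i ∈ lower j) : rank i < rank j := by simpa [lower] using hi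
  let c : ι → R := (measure rank).wf.fix fun j c =>
    g j - ∑ i ∈ (lower j).attach, c i (rank_lt i.2) * m i j
  have c_eq (j : ι) : c j = g j - ∑ i ∈ lower j, c i * m i j := by
    rw [← sum_attach (lower j) fun i => c i * m i j]
    exact (measure rank).wf.fix_eq _ j
  refine ⟨c, fun j => by rw [c_eq j, sub_add_cancel], fun c' hc' => funext fun j => ?_⟩
  induction j using (measure rank).wf.induction with
  | _ j ih =>
    rw [c_eq, ← hc' j, sum_congr rfl fun i hi => by rw [ih i (rank_lt hi)], add_sub_cancel_right]

end UnitriangularSystem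

section LetterSum

variable {N : ℕ∞}

/-- The weighted degree of a monomial in `x` in which `x_i` has degree `i`. -/
def letterSum (N : ℕ∞) : (Alphabet N →₀ ℕ) →+ ℕ := Finsupp.weight fun i => i.1 + 1

theorem letterSum_single (i : Alphabet N) (n : ℕ) :
    letterSum N (Finsupp.single i n) = n * (i.1 + 1) := by
  rw [letterSum, Finsupp.weight_single, smul_eq_mul]

theorem letterSum_swap_lt {α : Alphabet N →₀ ℕ} {i j : Alphabet N} (hij : i < j)
    (h : α i < α j) : letterSum N (α.mapDomain (Equiv.swap i j)) < letterSum N α := by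
  obtain ⟨d, hd⟩ := Nat.exists_eq_add_of_lt h
  have exchange : α.mapDomain (Equiv.swap i j) + Finsupp.single j (d + 1) =
      α + Finsupp.single i (d + 1) := by
    ext k
    rw [Finsupp.add_apply, Finsupp.add_apply, Finsupp.mapDomain_equiv_apply, Equiv.symm_swap]
    obtain rfl | hki := eq_or_ne k i
    · rw [Equiv.swap_apply_left, Finsupp.single_eq_same, Finsupp.single_eq_of_ne hij.ne]
      omega
    obtain rfl | hkj := eq_or_ne k j
    · rw [Equiv.swap_apply_right, Finsupp.single_eq_same, Finsupp.single_eq_of_ne hij.ne']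
      omega
    rw [Equiv.swap_apply_of_ne_of_ne hki hkj, Finsupp.single_eq_of_ne hki,
      Finsupp.single_eq_of_ne hkj]
  have letterSum_exchange := congrArg (letterSum N) exchange
  rw [map_add, map_add, letterSum_single, letterSum_single] at letterSum_exchange
  have : (d + 1) * (i.1 + 1) < (d + 1) * (j.1 + 1) := by gcongr
  omega

theorem IsSymmetricX.ext_antitone {f g : XSeries N} (hf : IsSymmetricX f) (hg : IsSymmetricX g)
    (h : ∀ α : Alphabet N →₀ ℕ, Antitone α → f.coeff α = g.coeff α) : f = g := by
  rw [isSymmetricX_iff] at hf hg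
  refine MvPowerSeries.ext fun α => ?_
  induction α using (measure (letterSum N)).wf.induction with
  | _ α ih =>
    by_cases hα : Antitone α
    · exact h α hα
    · rw [antitone_iff_forall_lt] at hα
      push Not at hα
      obtain ⟨i, j, hij, hlt⟩ := hα
      rw [← hf (Equiv.swap i j), ← hg (Equiv.swap i j)]
      exact ih _ (letterSum_swap_lt hij hlt)

end LetterSum

section RowExponent

variable {N : ℕ∞} {lam : YoungDiagram}

theorem letterSum_xExp {mu : YoungDiagram} (T : EdgeLabeledTableau (Alphabet N) lam mu) :
    letterSum N T.xExp = ∑ b, ((T.entry b).1 + 1) + ∑ p ∈ T.labels, (p.2.1 + 1) := by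
  simp only [EdgeLabeledTableau.xExp, SkewTableau.xExp, map_add, map_sum, letterSum_single, one_mul]

theorem row_le_entry (T : SkewTableau (Alphabet N) lam ⊥)
    (b : ↥(lam.cells \ (⊥ : YoungDiagram).cells)) :
    b.1.1 ≤ (T.entry b).1 := by
  obtain ⟨⟨i, j⟩, hb⟩ := b
  induction i with
  | zero => exact Nat.zero_le _
  | succ i ih =>
    have hb' : (i, j) ∈ lam.cells \ (⊥ : YoungDiagram).cells := by
      rw [YoungDiagram.cells_bot, sdiff_empty] at hb ⊢
      exact lam.up_left_mem (Nat.le_succ i) le_rfl hb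
    have : (T.entry ⟨(i, j), hb'⟩).1 < (T.entry ⟨(i + 1, j), hb⟩).1 :=
      T.col_strict ⟨_, hb'⟩ ⟨_, hb⟩ rfl (Nat.lt_succ_self i)
    exact (ih hb').trans_lt this

/-- The sum of the numbers of the rows (counted from `1`) of all boxes of a Young diagram, the least
possible sum of the entries of a semistandard tableau of this shape. -/
def rowSum (lam : YoungDiagram) : ℕ := ∑ c ∈ lam.cells, (c.1 + 1)

theorem rowSum_eq_sum_cells_sdiff_bot (lam : YoungDiagram) :
    rowSum lam = ∑ b : ↥(lam.cells \ (⊥ : YoungDiagram).cells), (b.1.1 + 1) := by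
  rw [sum_coe_sort (lam.cells \ (⊥ : YoungDiagram).cells) fun c => c.1 + 1, YoungDiagram.cells_bot,
    sdiff_empty, rowSum]

theorem rowSum_le_letterSum (T : EdgeLabeledTableau (Alphabet N) lam ⊥) :
    rowSum lam ≤ letterSum N T.xExp := by
  rw [letterSum_xExp, rowSum_eq_sum_cells_sdiff_bot]
  exact le_add_right
    (sum_le_sum fun b _ => Nat.add_le_add_right (row_le_entry T.toSkewTableau b) 1)

theorem entry_eq_row_of_letterSum_eq {T : EdgeLabeledTableau (Alphabet N) lam ⊥}
    (h : letterSum N T.xExp = rowSum lam) : (∀ b, (T.entry b).1 = b.1.1) ∧ T.labels = ∅ := by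
  rw [letterSum_xExp, rowSum_eq_sum_cells_sdiff_bot] at h
  have row_le (b) (_ : b ∈ univ) : b.1.1 + 1 ≤ (T.entry b).1 + 1 :=
    Nat.add_le_add_right (row_le_entry T.toSkewTableau b) 1
  have sum_row_le := sum_le_sum row_le
  constructor
  · have sum_row_eq := (sum_eq_sum_iff_of_le row_le).1 (by omega)
    exact fun b => (Nat.add_right_cancel (sum_row_eq b (mem_univ b))).symm
  · have sum_labels_eq_zero : ∑ p ∈ T.labels, (p.2.1 + 1) = 0 := by omega
    exact eq_empty_of_forall_notMem fun p hp => by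
      simpa using sum_eq_zero_iff.1 sum_labels_eq_zero p hp

/-- The semistandard tableau of straight shape whose entries in row `i` are all equal to `i`. -/
def superstandard (lam : PartitionOfLength N) : SkewTableau (Alphabet N) lam.1 ⊥ where
  entry b := ⟨b.1.1, by
    have row_lt : b.1.1 < lam.1.colLen 0 :=
      (YoungDiagram.mem_iff_lt_colLen.1 (mem_sdiff.1 b.2).1).trans_le
        (lam.1.colLen_anti 0 b.1.2 (Nat.zero_le _))
    exact (Nat.cast_lt.2 row_lt).trans_le lam.2⟩
  row_weak _ _ h _ := h.le
  col_strict _ _ _ h := h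

theorem eq_superstandard {lam : PartitionOfLength N}
    {T : EdgeLabeledTableau (Alphabet N) lam.1 ⊥} (h : letterSum N T.xExp = rowSum lam.1) :
    T = (superstandard lam).toEdgeLabeledTableau :=
  have ⟨entry_eq, labels_eq⟩ := entry_eq_row_of_letterSum_eq h
  EdgeLabeledTableau.ext (funext fun b => Subtype.ext (entry_eq b)) labels_eq

/-- The exponent of the monomial `x ^ lam = ∏ x_i ^ lam_i`. It is defined as the weight of the
superstandard tableau; see `rowExp_apply` for its values. -/
def rowExp (lam : PartitionOfLength N) : Alphabet N →₀ ℕ :=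
  (superstandard lam).toEdgeLabeledTableau.xExp

theorem rowExp_apply (lam : PartitionOfLength N) (i : Alphabet N) :
    rowExp lam i = lam.1.rowLen i.1 := by
  have single_entry_apply (b : ↥(lam.1.cells \ (⊥ : YoungDiagram).cells)) :
      (Finsupp.single ((superstandard lam).entry b) 1 : Alphabet N →₀ ℕ) i =
        if b.1.1 = i.1 then 1 else 0 := by
    simp only [Finsupp.single_apply, superstandard, Subtype.ext_iff]
  rw [rowExp, EdgeLabeledTableau.xExp, SkewTableau.toEdgeLabeledTableau, sum_empty, add_zero,
    SkewTableau.xExp, Finsupp.finsetSum_apply, sum_congr rfl fun b _ => single_entry_apply b,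
    sum_coe_sort (lam.1.cells \ (⊥ : YoungDiagram).cells) fun c => if c.1 = i.1 then 1 else 0,
    YoungDiagram.cells_bot, sdiff_empty, YoungDiagram.rowLen_eq_card, YoungDiagram.row, card_filter]

theorem rowLen_eq_zero_of_le (lam : PartitionOfLength N) {i : ℕ} (hi : N ≤ i) :
    lam.1.rowLen i = 0 :=
  rowLen_eq_zero_of_colLen_le (Nat.cast_le.1 (lam.2.trans hi))

theorem rowExp_injective : Function.Injective (rowExp (N := N)) := by
  refine fun lam mu h => Subtype.ext (eq_of_rowLen_eq fun i => ?_)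
  rcases lt_or_ge (i : ℕ∞) N with hi | hi
  · rw [← rowExp_apply lam ⟨i, hi⟩, ← rowExp_apply mu ⟨i, hi⟩, h]
  · rw [rowLen_eq_zero_of_le lam hi, rowLen_eq_zero_of_le mu hi]

theorem letterSum_rowExp (lam : PartitionOfLength N) :
    letterSum N (rowExp lam) = rowSum lam.1 := by
  rw [rowExp, letterSum_xExp, rowSum_eq_sum_cells_sdiff_bot]
  rfl

theorem degree_rowExp (lam : PartitionOfLength N) : (rowExp lam).degree = lam.1.card :=
  (superstandard lam).toEdgeLabeledTableau.degree_xExp_add_card bot_le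

theorem exists_rowExp_eq {α : Alphabet N →₀ ℕ} (hα : Antitone α) :
    ∃ lam : PartitionOfLength N, rowExp lam = α := by
  classical
  let r : ℕ → ℕ := fun i => if h : (i : ℕ∞) < N then α ⟨i, h⟩ else 0
  have r_antitone : Antitone r := by
    intro i i' hii
    simp only [r]
    split_ifs with h' h h
    · exact hα (Subtype.mk_le_mk.2 hii)
    · exact absurd ((Nat.cast_le.2 hii).trans_lt h') h
    · exact Nat.zero_le _
    · exact le_rfl
  have r_eventually_zero : r (α.support.sup fun i => i.1 + 1) = 0 := by
    refine dite_eq_right_iff.2 fun hlt => by_contra fun hne => ?_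
    exact (Nat.lt_succ_self _).not_ge (le_sup (f := fun i : Alphabet N => i.1 + 1)
      (Finsupp.mem_support_iff.2 hne))
  obtain ⟨nu, hnu⟩ := exists_rowLen_eq r_antitone r_eventually_zero
  refine ⟨⟨nu, ?_⟩, Finsupp.ext fun i => ?_⟩
  · cases hlen : nu.colLen 0 with
    | zero => exact zero_le
    | succ i =>
      have r_pos : 0 < r i := by
        rw [← hnu, lt_rowLen_iff_lt_colLen, hlen]
        exact Nat.lt_succ_self i
      push_cast
      exact Order.add_one_le_of_lt (by_contra fun h => r_pos.ne' (dif_neg h))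
  · rw [rowExp_apply, hnu]
    exact dif_pos i.2

theorem IsSymmetricX.ext_rowExp {f g : XSeries N} (hf : IsSymmetricX f) (hg : IsSymmetricX g)
    (h : ∀ lam : PartitionOfLength N, f.coeff (rowExp lam) = g.coeff (rowExp lam)) : f = g := by
  refine hf.ext_antitone hg fun α hα => ?_
  obtain ⟨lam, rfl⟩ := exists_rowExp_eq hα
  exact h lam

end RowExponent

section Expansion

variable {N : ℕ∞} {f : XSeries N} {c : PartitionOfLength N → ASeries}

theorem rowSum_le_of_coeff_ne_zero {lam : YoungDiagram} {α : Alphabet N →₀ ℕ}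
    (h : (edgeSchur N lam ⊥).coeff α ≠ 0) : rowSum lam ≤ letterSum N α := by
  obtain ⟨T, rfl⟩ := exists_tableau_of_coeff_ne_zero h
  exact rowSum_le_letterSum T

theorem eq_or_rowSum_lt_of_coeff_rowExp_ne_zero {lam mu : PartitionOfLength N}
    (h : (edgeSchur N mu.1 ⊥).coeff (rowExp lam) ≠ 0) : mu = lam ∨ rowSum mu.1 < rowSum lam.1 := by
  have rowSum_le := rowSum_le_of_coeff_ne_zero h
  rw [letterSum_rowExp] at rowSum_le
  refine rowSum_le.eq_or_lt.imp_left fun rowSum_eq => rowExp_injective ?_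
  obtain ⟨T, hT⟩ := exists_tableau_of_coeff_ne_zero h
  rw [← hT, eq_superstandard (T := T) (by rw [hT, letterSum_rowExp, rowSum_eq]), rowExp]

theorem coeff_rowExp_self (lam : PartitionOfLength N) :
    (edgeSchur N lam.1 ⊥).coeff (rowExp lam) = 1 := by
  classical
  ext β
  have tableauxOfWeight_eq : tableauxOfWeight lam.1 ⊥ (rowExp lam) β =
      {T | T = (superstandard lam).toEdgeLabeledTableau ∧ β = 0} := by
    refine Set.ext fun T => ⟨fun ⟨hx, ha⟩ => ?_, ?_⟩
    · obtain rfl := eq_superstandard (by rw [hx, letterSum_rowExp])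
      exact ⟨rfl, ha.symm⟩
    · rintro ⟨rfl, rfl⟩
      exact ⟨rfl, rfl⟩
  rw [coeff_edgeSchur bot_le, MvPowerSeries.coeff_one, tableauxOfWeight_eq]
  split_ifs with hβ <;> simp [hβ]

theorem finite_card_le (N : ℕ∞) (n : ℕ) : {lam : PartitionOfLength N | lam.1.card ≤ n}.Finite := by
  refine ((finite_cells_subset (range n ×ˢ range n)).preimage
    Subtype.val_injective.injOn).subset ?_
  rintro lam (hlam : #lam.1.cells ≤ n) ⟨i, j⟩ hij
  have colLen_le : lam.1.colLen j ≤ #lam.1.cells := by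
    rw [YoungDiagram.colLen_eq_card]
    exact card_le_card (filter_subset _ _)
  have rowLen_le : lam.1.rowLen i ≤ #lam.1.cells := by
    rw [YoungDiagram.rowLen_eq_card]
    exact card_le_card (filter_subset _ _)
  rw [mem_product, mem_range, mem_range]
  exact ⟨(YoungDiagram.mem_iff_lt_colLen.1 hij).trans_le (colLen_le.trans hlam),
    (YoungDiagram.mem_iff_lt_rowLen.1 hij).trans_le (rowLen_le.trans hlam)⟩

theorem card_le_rowSum (lam : YoungDiagram) : lam.card ≤ rowSum lam := by
  rw [YoungDiagram.card, card_eq_sum_ones]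
  exact sum_le_sum fun c _ => Nat.le_add_left 1 c.1

theorem finite_rowSum_lt (N : ℕ∞) (n : ℕ) :
    {lam : PartitionOfLength N | rowSum lam.1 < n}.Finite :=
  (finite_card_le N n).subset fun lam h => (card_le_rowSum lam.1).trans (le_of_lt h)

theorem finite_coeff_ne_zero (α : Alphabet N →₀ ℕ) :
    {lam : PartitionOfLength N | (edgeSchur N lam.1 ⊥).coeff α ≠ 0}.Finite :=
  (finite_rowSum_lt N (letterSum N α + 1)).subset fun _ h =>
    Nat.lt_succ_of_le (rowSum_le_of_coeff_ne_zero h)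

theorem isExpansion_iff (hf : IsSymmetricX f) :
    IsExpansion c f ↔ ∀ lam : PartitionOfLength N,
      ∑ᶠ mu : PartitionOfLength N, c mu * (edgeSchur N mu.1 ⊥).coeff (rowExp lam) =
        f.coeff (rowExp lam) := by
  refine ⟨fun hc lam => (hc (rowExp lam)).2.symm, fun h α =>
    ⟨(finite_coeff_ne_zero α).subset fun _ => right_ne_zero_of_mul, ?_⟩⟩
  let g : XSeries N := fun α =>
    ∑ᶠ mu : PartitionOfLength N, c mu * (edgeSchur N mu.1 ⊥).coeff α
  have isSymmetricX_g : IsSymmetricX g := isSymmetricX_iff.2 fun e α =>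
    finsum_congr fun mu => by rw [isSymmetricX_iff.1 (isSymmetricX_edgeSchur N mu.1 ⊥)]
  rw [hf.ext_rowExp isSymmetricX_g fun lam => (h lam).symm]
  rfl

theorem existsUnique_isExpansion (hf : IsSymmetricX f) :
    ∃! c : PartitionOfLength N → ASeries, IsExpansion c f := by
  simp only [isExpansion_iff hf]
  exact existsUnique_finsum_mul_eq (finite_rowSum_lt N) coeff_rowExp_self
    (fun _ _ => eq_or_rowSum_lt_of_coeff_rowExp_ne_zero) fun lam => f.coeff (rowExp lam)

end Expansion

section BoundedDegree

variable {N : ℕ∞} {f : XSeries N} {c : PartitionOfLength N → ASeries}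

theorem degree_of_coeff_coeff_ne_zero {lam : YoungDiagram} {α : Alphabet N →₀ ℕ} {β : ℤ →₀ ℕ}
    (h : ((edgeSchur N lam ⊥).coeff α).coeff β ≠ 0) : α.degree = lam.card + β.degree :=
  degree_add_card_of_coeff_ne_zero h

theorem IsExpansion.card_le_of_coeff_ne_zero (hc : IsExpansion c f) {β : ℤ →₀ ℕ} {d : ℕ}
    (hd : ∀ γ ≤ β, ∀ α : Alphabet N →₀ ℕ, (f.coeff α).coeff γ ≠ 0 → α.degree ≤ d)
    {lam : PartitionOfLength N} {γ : ℤ →₀ ℕ} (hγ : γ ≤ β) (h : (c lam).coeff γ ≠ 0) :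
    lam.1.card ≤ d + γ.degree := by
  classical
  induction lam using (measure fun lam : PartitionOfLength N => rowSum lam.1).wf.induction
    generalizing γ with
  | _ lam ih =>
    by_contra! hlt
    have f_coeff_eq_zero : (f.coeff (rowExp lam)).coeff γ = 0 := by
      by_contra hne
      have := hd γ hγ _ hne
      rw [degree_rowExp] at this
      omega
    rw [(hc _).2, finsum_mul_eq_add_sum (finite_rowSum_lt N) coeff_rowExp_self
      (fun _ _ => eq_or_rowSum_lt_of_coeff_rowExp_ne_zero), map_add, map_sum,
      sum_eq_zero, add_zero] at f_coeff_eq_zero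
    · exact h f_coeff_eq_zero
    intro mu hmu
    rw [MvPowerSeries.coeff_mul]
    refine sum_eq_zero fun p hp => by_contra fun hne => ?_
    obtain rfl := mem_antidiagonal.1 hp
    have card_mu_le := ih mu ((finite_rowSum_lt N _).mem_toFinset.1 hmu)
      (le_self_add.trans hγ) (left_ne_zero_of_mul hne)
    have card_lam_eq := degree_of_coeff_coeff_ne_zero (right_ne_zero_of_mul hne)
    rw [degree_rowExp] at card_lam_eq
    rw [map_add] at hlt
    omega

theorem IsExpansion.finite_coeff_ne_zero (hc : IsExpansion c f) (hf : HasBoundedDegreeX f)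
    (β : ℤ →₀ ℕ) : {lam : PartitionOfLength N | (c lam).coeff β ≠ 0}.Finite := by
  choose d hd using hf
  have degree_le (γ) (hγ : γ ≤ β) (α : Alphabet N →₀ ℕ) (h : (f.coeff α).coeff γ ≠ 0) :
      α.degree ≤ (Iic β).sup d :=
    (hd γ α h).trans (le_sup (mem_Iic.2 hγ))
  exact (finite_card_le N _).subset fun lam h => hc.card_le_of_coeff_ne_zero degree_le le_rfl h

theorem IsExpansion.hasBoundedDegreeX (hc : IsExpansion c f)
    (hfin : ∀ β : ℤ →₀ ℕ, {lam : PartitionOfLength N | (c lam).coeff β ≠ 0}.Finite) :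
    HasBoundedDegreeX f := by
  classical
  intro β
  obtain ⟨D, hD⟩ := (((Iic β).finite_toSet.biUnion fun γ _ => hfin γ).image
    fun lam => lam.1.card).bddAbove
  refine ⟨D + β.degree, fun α hα => ?_⟩
  rw [(hc α).2, finsum_eq_sum _ (hc α).1, map_sum] at hα
  obtain ⟨lam, -, hlam⟩ := exists_ne_zero_of_sum_ne_zero hα
  rw [MvPowerSeries.coeff_mul] at hlam
  obtain ⟨p, hp, hne⟩ := exists_ne_zero_of_sum_ne_zero hlam
  obtain rfl := mem_antidiagonal.1 hp
  have card_le : lam.1.card ≤ D := hD ⟨lam, Set.mem_biUnion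
    (mem_coe.2 (mem_Iic.2 le_self_add)) (left_ne_zero_of_mul hne), rfl⟩
  rw [degree_of_coeff_coeff_ne_zero (right_ne_zero_of_mul hne), map_add]
  omega

theorem IsExpansion.hasBoundedDegreeX_iff (hc : IsExpansion c f) :
    HasBoundedDegreeX f ↔
      ∀ β : ℤ →₀ ℕ, {lam : PartitionOfLength N | (c lam).coeff β ≠ 0}.Finite :=
  ⟨hc.finite_coeff_ne_zero, hc.hasBoundedDegreeX⟩

end BoundedDegree

end EdgeSchur

end

open EdgeSchur in
/-- Throughout, `N` is the number of variables `x`, finite or `⊤`. -/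
theorem mainTheorem1 (N : ℕ∞) :
    -- the generating series are well defined: each weight occurs finitely often
    (∀ (lam mu : YoungDiagram) (α : Alphabet N →₀ ℕ) (β : ℤ →₀ ℕ),
      (tableauxOfWeight (σ := Alphabet N) lam mu α β).Finite) ∧
    -- the (skew) edge Schur functions are symmetric functions
    (∀ lam mu : YoungDiagram,
      IsSymmetricX (edgeSchur N lam mu) ∧ HasBoundedDegreeX (edgeSchur N lam mu)) ∧
    -- `E^{lam/mu} = s_{lam/mu} +` terms of higher order, both in `x` and in `a`
    (∀ lam mu : YoungDiagram, mu ≤ lam → ∃ H : XSeries N,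
      edgeSchur N lam mu = MvPowerSeries.map MvPowerSeries.C (skewSchur N lam mu) + H ∧
      ∀ (α : Alphabet N →₀ ℕ) (β : ℤ →₀ ℕ), (H.coeff α).coeff β ≠ 0 →
        0 < β.degree ∧ α.degree + mu.card = lam.card + β.degree) ∧
    -- the family `E^lam` is locally finite, so that every family of coefficients can be summed
    (∀ α : Alphabet N →₀ ℕ,
      {lam : PartitionOfLength N | (edgeSchur N lam.1 ⊥).coeff α ≠ 0}.Finite) ∧
    -- it is a basis of the completed ring of symmetric functions over `ℤ⟦a⟧`
    (∀ f : XSeries N, IsSymmetricX f →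
      ∃! c : PartitionOfLength N → ASeries, IsExpansion c f) ∧
    -- and it is a basis of the completion `Λ⟦a⟧`: the elements of `Λ⟦a⟧` are those whose expansion
    -- involves each monomial `a ^ β` in only finitely many coefficients
    (∀ (f : XSeries N) (c : PartitionOfLength N → ASeries), IsExpansion c f →
      (HasBoundedDegreeX f ↔
        ∀ β : ℤ →₀ ℕ, {lam : PartitionOfLength N | (c lam).coeff β ≠ 0}.Finite)) := by
  refine ⟨finite_tableauxOfWeight, fun lam mu => ⟨isSymmetricX_edgeSchur N lam mu,
    hasBoundedDegreeX_edgeSchur N lam mu⟩, fun lam mu => exists_edgeSchur_eq_map_skewSchur_add N,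
    finite_coeff_ne_zero, fun f => existsUnique_isExpansion,
    fun f c => IsExpansion.hasBoundedDegreeX_iff⟩
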